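/- Let $G$ be a group. A full family of subgroups of $G$ is a non-empty set of subgroups of $G$ that is closed under conjugation and under passing to subgroups. For a set $\mathfrak F$ of subgroups of $G$, the orbit category $\mathcal O_{\mathfrak F}G$ has as objects the $G$-sets $G/H$ with $H\in\mathfrak F$ and as morphisms the $G$-maps; right (left) Bredon modules are the contravariant (covariant) functors from $\mathcal O_{\mathfrak F}G$ to abelian groups, and $\underline{\mathbb Z}_{\mathfrak F}$ is the constant right Bredon module with value $\mathbb Z$. For a right module $M$ and a left module $N$, $M\otimes_{\mathfrak F}N$ is the quotient of $\bigoplus_{H\in\mathfrak F}M(G/H)\otimes_{\mathbb Z}N(G/H)$ by the subgroup generated by all $\varphi^*m\otimes n-m\otimes\varphi_*n$, and $M$ is flat if $M\otimes_{\mathfrak F}-$ is exact. The Bredon cohomological dimension $\operatorname{cd}_{\mathfrak F}G$ (homological dimension $\operatorname{hd}_{\mathfrak F}G$) in $\mathbb N\cup\{\infty\}$ is the least $n$ for which $\underline{\mathbb Z}_{\mathfrak F}$ has a resolution $0\to P_n\to\dots\to P_0\to\underline{\mathbb Z}_{\mathfrak F}\to0$ by projective (flat) right Bredon modules, and $\infty$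 if there is no such $n$. (a) Let $G$ be the direct union of a family of subgroups $(G_\lambda)_{\lambda\in\Lambda}$, that is, for all $\lambda,\mu\in\Lambda$ there is $\nu\in\Lambda$ with $G_\lambda\le G_\nu$ and $G_\mu\le G_\nu$, and every $g\in G$ lies in some $G_\lambda$. Let $\mathfrak F$ be a full family of subgroups of $G$ and, for each $\lambda\in\Lambda$, let $\mathfrak F_\lambda$ be a full family of subgroups of $G_\lambda$. Assume that these families are compatible with the direct union: $\mathfrak F_\lambda\subseteq\mathfrak F_\mu$ whenever $G_\lambda\le G_\mu$; $\mathfrak F_\lambda\subseteq\mathfrak F$ for all $\lambda$; $\mathfrak F\subseteq\bigcup_{\lambda}\mathfrak F_\lambda$; and $\mathfrak F_\lambda=\{H\cap G_\lambda: H\in\mathfrak F\}$ for all $\lambda\in\Lambda$. Then $$\operatorname{hd}_{\mathfrak F}G\le\sup_{\lambda\in\Lambda}\operatorname{hd}_{\mathfrak F_\lambda}G_\lambda ,$$ and, if $\Lambda$ is countable, $$\operatorname{cd}_{\mathfrak F}G\le\sup_{\lambda\in\Lambda}\operatorname{cd}_{\mathfrak F_\lambda}G_\lambda+1 .$$ (b)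 Let $\mathfrak F_{\mathrm{vc}}(G)$ be the family of virtually cyclic subgroups of $G$ (those with a cyclic subgroup of finite index). If $G$ is locally virtually cyclic, that is, every finitely generated subgroup of $G$ is virtually cyclic, then $\operatorname{hd}_{\mathfrak F_{\mathrm{vc}}(G)}G=0$; if in addition $G$ is countable, then $\operatorname{cd}_{\mathfrak F_{\mathrm{vc}}(G)}G\le1$. -/

import Mathlib

open CategoryTheory Opposite
open scoped TensorProduct

universe u v

namespace Bredon

/-! ### Families of subgroups -/

section Families

variable {G : Type u} [Group G]

/-- A full family of subgroups of `G`: a non-empty set of subgroups which is closed under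
conjugation and under passing to subgroups. -/
structure IsFullFamily (F : Set (Subgroup G)) : Prop where
  nonempty : F.Nonempty
  conj_mem : ∀ H ∈ F, ∀ g : G, H.map (MulAut.conj g).toMonoidHom ∈ F
  subgroup_mem : ∀ H ∈ F, ∀ K : Subgroup G, K ≤ H → K ∈ F

/-- For a set `F` of subgroups of `G` and a subgroup `K` of `G`, this is
`F ∩ K = {H ∩ K : H ∈ F}`, as a set of subgroups of `K`. -/
def familyInter (F : Set (Subgroup G)) (K : Subgroup G) : Set (Subgroup K) :=
  {L | ∃ H ∈ F, L = H.subgroupOf K}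

/-- For a set `E` of subgroups of a subgroup `K` of `G`, the same set, with its members
regarded as subgroups of `G`. -/
def familyIncl {K : Subgroup G} (E : Set (Subgroup K)) : Set (Subgroup G) :=
  {L | ∃ H ∈ E, L = H.map K.subtype}

/-- A group is virtually cyclic if it has a cyclic subgroup of finite index. -/
def IsVirtuallyCyclic (H : Type u) [Group H] : Prop :=
  ∃ C : Subgroup H, IsCyclic C ∧ C.FiniteIndex

variable (G) in
/-- The family of virtually cyclic subgroups of `G`. -/
def vcFamily : Set (Subgroup G) :=
  {H | IsVirtuallyCyclic H}

variable (G) in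
/-- A group is locally virtually cyclic if all its finitely generated subgroups are virtually
cyclic. -/
def IsLocallyVirtuallyCyclic : Prop :=
  ∀ H : Subgroup G, H.FG → IsVirtuallyCyclic H

/-- `G` is the direct union of its subgroups `S i`. -/
structure IsDirectUnion {Λ : Type v} (S : Λ → Subgroup G) : Prop where
  directed : ∀ i j, ∃ k, S i ≤ S k ∧ S j ≤ S k
  exists_mem : ∀ g : G, ∃ i, g ∈ S i

/-- The set `F` of subgroups of `G` and the sets `E i` of subgroups of `S i` are compatible with
the direct union of the `S i`. -/
structure IsCompatible {Λ : Type v} (S : Λ → Subgroup G) (F : Set (Subgroup G))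
    (E : ∀ i, Set (Subgroup (S i))) : Prop where
  mono : ∀ i j, S i ≤ S j → familyIncl (E i) ⊆ familyIncl (E j)
  incl_subset : ∀ i, familyIncl (E i) ⊆ F
  subset_iUnion : F ⊆ ⋃ i, familyIncl (E i)
  eq_inter : ∀ i, E i = familyInter F (S i)

end Families

/-! ### The orbit category and Bredon modules -/

/-- The objects of the orbit category of `G` with respect to `F`: an object stands for the
homogeneous `G`-set `G ⧸ H` with `H ∈ F`. -/
structure OrbitCat {G : Type u} [Group G] (F : Set (Subgroup G)) : Type u where
  subgroup : Subgroup G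
  mem : subgroup ∈ F

section Modules

variable {G : Type u} [Group G] (F : Set (Subgroup G))

/-- Morphisms in the orbit category are `G`-maps. -/
instance : Category.{u} (OrbitCat F) where
  Hom X Y := (G ⧸ X.subgroup) →[G] (G ⧸ Y.subgroup)
  id X := MulActionHom.id G
  comp f g := g.comp f

/-- Right Bredon modules: contravariant functors to abelian groups. -/
abbrev RightModule := (OrbitCat F)ᵒᵖ ⥤ AddCommGrpCat.{u}

/-- Left Bredon modules: covariant functors to abelian groups. -/
abbrev LeftModule := OrbitCat F ⥤ AddCommGrpCat.{u}

/-- The trivial right Bredon module: the constant functor with value `ℤ`. -/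
def trivialModule : RightModule F :=
  (Functor.const _).obj (AddCommGrpCat.of (ULift.{u} ℤ))

variable {F}

/-- The direct sum of the groups `M(G/H) ⊗ N(G/H)` over all `H ∈ F`. -/
abbrev TensorSum (M : RightModule F) (N : LeftModule F) : Type u :=
  DirectSum (OrbitCat F) fun X => (M.obj (op X)) ⊗[ℤ] (N.obj X)

open Classical in
/-- The subgroup generated by all `φ^* m ⊗ n - m ⊗ φ_* n`. -/
def tensorRel (M : RightModule F) (N : LeftModule F) : AddSubgroup (TensorSum M N) :=
  AddSubgroup.closure {x | ∃ (X Y : OrbitCat F) (φ : X ⟶ Y) (m : M.obj (op Y)) (n : N.obj X),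
    x = DirectSum.of (fun X => (M.obj (op X)) ⊗[ℤ] (N.obj X)) X (M.map φ.op m ⊗ₜ[ℤ] n) -
      DirectSum.of (fun X => (M.obj (op X)) ⊗[ℤ] (N.obj X)) Y (m ⊗ₜ[ℤ] N.map φ n)}

/-- The tensor product `M ⊗_F N` of a right and a left Bredon module. -/
abbrev Tensor (M : RightModule F) (N : LeftModule F) : Type u :=
  TensorSum M N ⧸ tensorRel M N

/-- The map induced by a morphism `g : N ⟶ N'` on the direct sums. -/
def tensorSumMap (M : RightModule F) {N N' : LeftModule F} (g : N ⟶ N') :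
    TensorSum M N →+ TensorSum M N' :=
  DirectSum.map fun X =>
    ((g.app X).hom.toIntLinearMap.lTensor (M.obj (op X))).toAddMonoidHom

open Classical in
@[simp]
lemma tensorSumMap_of (M : RightModule F) {N N' : LeftModule F} (g : N ⟶ N') (X : OrbitCat F)
    (m : M.obj (op X)) (n : N.obj X) :
    tensorSumMap M g (DirectSum.of (fun X => (M.obj (op X)) ⊗[ℤ] (N.obj X)) X (m ⊗ₜ[ℤ] n)) =
      DirectSum.of (fun X => (M.obj (op X)) ⊗[ℤ] (N'.obj X)) X (m ⊗ₜ[ℤ] g.app X n) := by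
  simp [tensorSumMap, DirectSum.map_of]

lemma tensorRel_le_comap (M : RightModule F) {N N' : LeftModule F} (g : N ⟶ N') :
    tensorRel M N ≤ (tensorRel M N').comap (tensorSumMap M g) := by
  classical
  refine (AddSubgroup.closure_le _).2 ?_
  rintro _ ⟨X, Y, φ, m, n, rfl⟩
  refine AddSubgroup.subset_closure ⟨X, Y, φ, m, g.app X n, ?_⟩
  rw [map_sub, tensorSumMap_of, tensorSumMap_of, NatTrans.naturality_apply]

/-- The map `M ⊗_F N → M ⊗_F N'` induced by a morphism `g : N ⟶ N'`. -/
def tensorMap (M : RightModule F) {N N' : LeftModule F} (g : N ⟶ N') :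
    Tensor M N →+ Tensor M N' :=
  QuotientAddGroup.map _ _ (tensorSumMap M g) (tensorRel_le_comap M g)

open Classical in
@[simp]
lemma tensorMap_of (M : RightModule F) {N N' : LeftModule F} (g : N ⟶ N') (X : OrbitCat F)
    (m : M.obj (op X)) (n : N.obj X) :
    tensorMap M g (QuotientAddGroup.mk
        (DirectSum.of (fun X => (M.obj (op X)) ⊗[ℤ] (N.obj X)) X (m ⊗ₜ[ℤ] n))) =
      QuotientAddGroup.mk
        (DirectSum.of (fun X => (M.obj (op X)) ⊗[ℤ] (N'.obj X)) X (m ⊗ₜ[ℤ] g.app X n)) := by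
  rw [tensorMap, QuotientAddGroup.map_mk, tensorSumMap_of]

open Classical in
lemma tensor_hom_ext {M : RightModule F} {N : LeftModule F} {A : Type*} [AddCommGroup A]
    {f g : Tensor M N →+ A}
    (h : ∀ (X : OrbitCat F) (m : M.obj (op X)) (n : N.obj X),
      f (QuotientAddGroup.mk
        (DirectSum.of (fun X => (M.obj (op X)) ⊗[ℤ] (N.obj X)) X (m ⊗ₜ[ℤ] n))) =
      g (QuotientAddGroup.mk
        (DirectSum.of (fun X => (M.obj (op X)) ⊗[ℤ] (N.obj X)) X (m ⊗ₜ[ℤ] n)))) :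
    f = g := by
  refine QuotientAddGroup.addMonoidHom_ext _ (DirectSum.addHom_ext fun X t => ?_)
  induction t using TensorProduct.induction_on with
  | zero => simp
  | tmul m n => exact h X m n
  | add a b ha hb => rw [map_add, map_add, map_add, ha, hb]

/-- The functor `M ⊗_F -` from left Bredon modules to abelian groups. -/
def tensorFunctor (M : RightModule F) : LeftModule F ⥤ AddCommGrpCat.{u} where
  obj N := AddCommGrpCat.of (Tensor M N)
  map g := AddCommGrpCat.ofHom (tensorMap M g)
  map_id N := by
    ext1
    exact tensor_hom_ext fun X m n => by simp
  map_comp f g := by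
    ext1
    exact tensor_hom_ext fun X m n => by simp

instance (M : RightModule F) : (tensorFunctor M).PreservesZeroMorphisms where
  map_zero N N' := by
    ext1
    refine tensor_hom_ext fun X m n => (tensorMap_of M 0 X m n).trans ?_
    rw [show (0 : N ⟶ N').app X n = 0 from rfl, TensorProduct.tmul_zero, map_zero]
    rfl

/-- A right Bredon module `M` is flat if the functor `M ⊗_F -` is exact. -/
def IsFlat (M : RightModule F) : Prop :=
  ∀ S : ShortComplex (LeftModule F), S.ShortExact → (S.map (tensorFunctor M)).ShortExact

end Modules

/-! ### Bredon dimensions -/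

/-- `M` has a resolution `0 → P_n → ⋯ → P_0 → M → 0` of length `n` in which every `P_i` has the
property `P`. The complex is continued by zero objects in the degrees above `n`. -/
def HasResolution {C : Type*} [Category C] [Abelian C] (P : C → Prop) (M : C) (n : ℕ) : Prop :=
  ∃ (K : ChainComplex C ℕ) (π : K ⟶ (ChainComplex.single₀ C).obj M),
    (∀ i ≤ n, P (K.X i)) ∧ (∀ i, n < i → Limits.IsZero (K.X i)) ∧ QuasiIso π

section Dimensions

variable (G : Type u) [Group G] (F : Set (Subgroup G))

/-- The Bredon cohomological dimension: the least length of a projective resolution of the trivial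
module, and `⊤` if there is no such resolution of finite length. -/
noncomputable def cd : ℕ∞ :=
  ⨅ (n : ℕ) (_ : HasResolution (fun M : RightModule F => Projective M) (trivialModule F) n),
    (n : ℕ∞)

/-- The Bredon homological dimension: the least length of a flat resolution of the trivial
module, and `⊤` if there is no such resolution of finite length. -/
noncomputable def hd : ℕ∞ :=
  ⨅ (n : ℕ) (_ : HasResolution (fun M : RightModule F => IsFlat M) (trivialModule F) n),
    (n : ℕ∞)

end Dimensions

end Bredon

/-! For a subgroup `K` let `ℤ[G/K]` be the right module `lin (cosetMaps F K)`, the free abelian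
groups on the `G`-maps from orbits into `G/K`. Two facts about these permutation modules give part
(a).

First, `ℤ[G/K]` is induced from the trivial module of `K` over `F ∩ K` (`orbitIndTrivialIso`). The
orbit category of `K` is the category of `G`-orbits over `G/K`, so induction is a pointwise direct
sum and hence exact; being left adjoint to the exact restriction, it also preserves projective and
flat modules. A resolution for `K` therefore induces one of `ℤ[G/K]` of the same length.

Second, the constant module `ℤ` is the colimit of the `ℤ[G/S i]` (`augIsColimit`): each `H ∈ F` lies
in some `S i`, so there are maps into `G/S i`, and any two maps become equal further along the
directed union.

For `hd`, flat dimension at most `n` is rewritten as the vanishing of torsion (`Res.torVanishes`,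
`res_of_torVanishes`), which survives filtered colimits. For `cd` and countable `Λ`, a cofinal
sequence has a mapping telescope `0 → ⨁ ℤ[G/K_i] → ⨁ ℤ[G/K_i] → ℤ → 0` (`telescope_shortExact`),
whose extra step costs the `+ 1`.

For (b), use the directed union of the finitely generated subgroups `D`. Each is virtually cyclic,
hence a member of its own family; `D/D` is then terminal in the orbit category, the trivial module
is projective, and both dimensions of `D` are zero. -/

namespace Bredon

/-! ### Finite resolutions as iterated syzygy sequences. -/

section Resolutions

open Limits ZeroObject

variable {C : Type*} [Category C] [Abelian C]

/-- `M` is obtained from `n` successive syzygy sequences whose middle terms, and whose last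
kernel, have the property `P`. -/
def Res (P : C → Prop) : ℕ → C → Prop
  | 0, M => P M
  | n + 1, M => ∃ S : ShortComplex C, S.ShortExact ∧ P S.X₂ ∧ Res P n S.X₁ ∧ Nonempty (S.X₃ ≅ M)

lemma Res.of_iso {P : C → Prop} (hP : ∀ ⦃M N : C⦄, (M ≅ N) → P M → P N) {n : ℕ} {M N : C}
    (e : M ≅ N) (hM : Res P n M) : Res P n N := by
  cases n with
  | zero => exact hP e hM
  | succ n =>
    obtain ⟨S, hS, h₂, h₁, ⟨e'⟩⟩ := hM
    exact ⟨S, hS, h₂, h₁, ⟨e' ≪≫ e⟩⟩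

/-- The last kernel `M` is padded by `0 → 0 → M → M → 0`. -/
lemma Res.succ {P : C → Prop} (h0 : ∀ Z, IsZero Z → P Z) {n : ℕ} {M : C}
    (hM : Res P n M) : Res P (n + 1) M := by
  induction n generalizing M with
  | zero =>
    refine ⟨ShortComplex.mk (0 : (0 : C) ⟶ M) (𝟙 M) (by simp), ?_, hM,
      h0 _ (isZero_zero C), ⟨Iso.refl _⟩⟩
    have : Mono (0 : (0 : C) ⟶ M) := (isZero_zero C).mono _
    exact { exact := (ShortComplex.exact_iff_mono _ (by simp)).2 (by dsimp; infer_instance)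
            mono_f := by dsimp; infer_instance
            epi_g := by dsimp; infer_instance }
  | succ n ih =>
    obtain ⟨S, hS, h₂, h₁, e⟩ := hM
    exact ⟨S, hS, h₂, ih h₁, e⟩

lemma Res.of_le {P : C → Prop} (h0 : ∀ Z, IsZero Z → P Z) {m n : ℕ} (h : m ≤ n) {M : C}
    (hM : Res P m M) : Res P n M := by
  induction n, h using Nat.le_induction with
  | base => exact hM
  | succ n _ ih => exact ih.succ h0

lemma Res.map {D : Type*} [Category D] [Abelian D] (L : C ⥤ D) [L.PreservesZeroMorphisms]
    (hL : ∀ S : ShortComplex C, S.ShortExact → (S.map L).ShortExact)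
    {P : C → Prop} {Q : D → Prop} (h : ∀ M, P M → Q (L.obj M)) {n : ℕ} {M : C}
    (hM : Res P n M) : Res Q n (L.obj M) := by
  induction n generalizing M with
  | zero => exact h M hM
  | succ n ih =>
    obtain ⟨S, hS, h₂, h₁, ⟨e⟩⟩ := hM
    exact ⟨S.map L, hL S hS, h _ h₂, ih h₁, ⟨L.mapIso e⟩⟩

/-- `K.opcycles j`, the cokernel of the incoming differential, serves as the `j`-th syzygy:
exactness makes `0 → opcycles (j + 1) → K_j → opcycles j → 0` short exact. At `j = n` the incoming
differential is zero, so the last syzygy is `K_n` itself. -/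
lemma res_of_exactAt {P : C → Prop} (hP : ∀ ⦃M N : C⦄, (M ≅ N) → P M → P N)
    (K : ChainComplex C ℕ) (n : ℕ) (hK : ∀ i ≤ n, P (K.X i))
    (h0 : IsZero (K.X (n + 1))) (hex : ∀ i, K.ExactAt (i + 1)) (k j : ℕ) (hkj : j + k = n) :
    Res P k (K.opcycles j) := by
  induction k generalizing j with
  | zero =>
    obtain rfl : j = n := by omega
    have : IsIso (K.pOpcycles j) := K.isIso_pOpcycles (j + 1) j (by simp) (h0.eq_of_src _ _)
    exact hP (asIso (K.pOpcycles j)) (hK j le_rfl)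
  | succ k ih =>
    let S : ShortComplex C := ShortComplex.mk (K.fromOpcycles (j + 1) j) (K.pOpcycles j) (by
      rw [← cancel_epi (K.pOpcycles (j + 1))]
      simp)
    refine ⟨S, ?_, hK j (by omega), ih (j + 1) (by omega), ⟨Iso.refl _⟩⟩
    have h1 : Mono S.f :=
      Preadditive.mono_of_isZero_kernel' _ (K.homologyIsKernel (j + 1) j (by simp))
        (HomologicalComplex.ExactAt.isZero_homology (hex j))
    let T : ShortComplex C := ShortComplex.mk (K.d (j + 1) j) (K.pOpcycles j) (by simp)
    have hT : T.Exact := T.exact_of_g_is_cokernel (K.opcyclesIsCokernel (j + 1) j (by simp))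
    -- Replacing `K_{j+1}` by its quotient `opcycles (j + 1)` does not change the image in `K_j`.
    let φ : T ⟶ S := { τ₁ := K.pOpcycles (j + 1), τ₂ := 𝟙 _, τ₃ := 𝟙 _ }
    have : Epi φ.τ₁ := by dsimp [φ]; infer_instance
    exact { exact := (ShortComplex.exact_iff_of_epi_of_isIso_of_mono φ).1 hT
            mono_f := h1
            epi_g := by dsimp [S]; infer_instance }

lemma HasResolution.res {P : C → Prop} (hP : ∀ ⦃M N : C⦄, (M ≅ N) → P M → P N) {M : C} {n : ℕ}
    (h : HasResolution P M n) : Res P n M := by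
  obtain ⟨K, π, hK, h0, hπ⟩ := h
  have hex : ∀ i, K.ExactAt (i + 1) := fun i => by
    rw [← quasiIsoAt_iff_exactAt' π]
    · infer_instance
    · exact ChainComplex.exactAt_succ_single_obj _ _
  refine Res.of_iso hP ?_ (res_of_exactAt hP K n hK (h0 _ (by omega)) hex n 0 (by omega))
  -- In degree 0 the outgoing differential vanishes, so `opcycles 0` is the homology, which the
  -- quasi-isomorphism identifies with `M`.
  exact K.isoHomologyι₀.symm ≪≫ asIso (HomologicalComplex.homologyMap π 0) ≪≫
    HomologicalComplex.singleObjHomologySelfIso _ _ _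

lemma Res.exists_complex {P : C → Prop} {M : C} {n : ℕ} (h : Res P n M) :
    ∃ (K : ChainComplex C ℕ) (p : K.X 0 ⟶ M) (w : K.d 1 0 ≫ p = 0),
      (∀ i ≤ n, P (K.X i)) ∧ (∀ i, n < i → IsZero (K.X i)) ∧
      (ShortComplex.mk _ _ w).Exact ∧ Epi p ∧ ∀ i, K.ExactAt (i + 1) := by
  induction n generalizing M with
  | zero =>
    refine ⟨(ChainComplex.single₀ C).obj M, 𝟙 M, zero_comp, ?_, ?_, ?_, ?_, ?_⟩
    · intro i hi
      obtain rfl : i = 0 := by omega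
      exact h
    · exact fun i hi => HomologicalComplex.isZero_single_obj_X _ _ _ _ (by omega)
    · exact (ShortComplex.exact_iff_mono _ rfl).2 (inferInstanceAs (Mono (𝟙 M)))
    · exact inferInstanceAs (Epi (𝟙 M))
    · exact fun i => ChainComplex.exactAt_succ_single_obj _ _
  | succ n ih =>
    obtain ⟨S, hS, h₂, h₁, ⟨e⟩⟩ := h
    obtain ⟨K, p, w, hK, h0, hex, hp, hex'⟩ := ih h₁
    have := hS.mono_f
    have := hS.epi_g
    -- Splicing: the resolution of `S.X₁` moves up one degree and `S.X₂` enters in degree 0.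
    refine ⟨K.augment (p ≫ S.f) (by rw [reassoc_of% w, zero_comp]), S.g ≫ e.hom, ?_, ?_, ?_,
      ?_, ?_, ?_⟩
    · exact (show (p ≫ S.f) ≫ S.g ≫ e.hom = 0 by simp)
    · rintro (_ | i) hi
      · exact h₂
      · exact hK i (by omega)
    · rintro (_ | i) hi
      · omega
      · exact h0 i (by omega)
    · let φ : ShortComplex.mk (p ≫ S.f) (S.g ≫ e.hom) (by simp) ⟶ S :=
        { τ₁ := p, τ₂ := 𝟙 _, τ₃ := e.inv }
      have : Epi φ.τ₁ := hp
      have : IsIso φ.τ₂ := by dsimp [φ]; infer_instance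
      have : Mono φ.τ₃ := by dsimp [φ]; infer_instance
      exact (ShortComplex.exact_iff_of_epi_of_isIso_of_mono φ).2 hS.exact
    · exact inferInstanceAs (Epi (S.g ≫ e.hom))
    · intro i
      rw [HomologicalComplex.exactAt_iff' _ (i + 2) (i + 1) i (by simp) (by simp)]
      cases i with
      | zero =>
        let φ : ShortComplex.mk (K.d 1 0) p w ⟶
            ShortComplex.mk (K.d 1 0) (p ≫ S.f) (by rw [reassoc_of% w, zero_comp]) :=
          { τ₁ := 𝟙 _, τ₂ := 𝟙 _, τ₃ := S.f }
        have : Epi φ.τ₁ := by dsimp [φ]; infer_instance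
        have : IsIso φ.τ₂ := by dsimp [φ]; infer_instance
        have : Mono φ.τ₃ := hS.mono_f
        exact (ShortComplex.exact_iff_of_epi_of_isIso_of_mono φ).1 hex
      | succ i =>
        have := hex' i
        rw [HomologicalComplex.exactAt_iff' _ (i + 2) (i + 1) i (by simp) (by simp)] at this
        exact this

lemma Res.hasResolution {P : C → Prop} {M : C} {n : ℕ} (h : Res P n M) :
    HasResolution P M n := by
  obtain ⟨K, p, w, hK, h0, hex, hp, hex'⟩ := h.exists_complex
  refine ⟨K, (ChainComplex.toSingle₀Equiv _ _).symm ⟨p, w⟩, hK, h0, ⟨fun n => ?_⟩⟩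
  cases n with
  | zero =>
    have hp0 : ((ChainComplex.toSingle₀Equiv K M).symm ⟨p, w⟩).f 0 = p := by simp
    rw [ChainComplex.quasiIsoAt₀_iff, ShortComplex.quasiIso_iff_of_zeros']
    · refine (ShortComplex.exact_and_epi_g_iff_of_iso ?_).2 ⟨hex, hp⟩
      exact ShortComplex.isoMk (Iso.refl _) (Iso.refl _) (Iso.refl _)
        ((Category.id_comp _).trans (Category.comp_id _).symm)
        ((Category.id_comp _).trans (hp0.symm.trans (Category.comp_id _).symm))
    · exact K.shape _ _ (by simp)
    all_goals rfl
  | succ n =>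
    rw [quasiIsoAt_iff_exactAt']
    · exact hex' n
    · exact ChainComplex.exactAt_succ_single_obj _ _

lemma Res.hasProjectiveDimensionLT {M : C} {n : ℕ} (h : Res (fun M : C => Projective M) n M) :
    HasProjectiveDimensionLT M (n + 1) := by
  induction n generalizing M with
  | zero =>
    have : Projective M := h
    infer_instance
  | succ n ih =>
    obtain ⟨S, hS, h₂, h₁, ⟨e⟩⟩ := h
    have := (hS.hasProjectiveDimensionLT_X₃_iff n h₂).2 (ih h₁)
    exact hasProjectiveDimensionLT_of_iso e _

/-- The dimension bound drops by one on passing to the kernel of any projective presentation. With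
the previous lemma, projective resolutions of length `n` are traded for projective dimension `< n +
1`, which behaves well in short exact sequences. -/
lemma res_of_hasProjectiveDimensionLT [EnoughProjectives C] {M : C} {n : ℕ}
    (h : HasProjectiveDimensionLT M (n + 1)) : Res (fun M : C => Projective M) n M := by
  induction n generalizing M with
  | zero => exact projective_iff_hasProjectiveDimensionLT_one.2 h
  | succ n ih =>
    have hS : (ShortComplex.mk (kernel.ι (Projective.π M)) (Projective.π M) (by simp)).ShortExact :=
      { exact := ShortComplex.exact_kernel _ }
    exact ⟨_, hS, inferInstance, ih ((hS.hasProjectiveDimensionLT_X₃_iff n inferInstance).1 h),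
      ⟨Iso.refl _⟩⟩

end Resolutions

/-! ### Pointwise exactness and enough projectives in functor categories. -/

section FunctorModules

open Limits

variable {C : Type u} [SmallCategory C]

/-- Evaluation is exact, so it commutes with homology, and a functor vanishes when all its values
do. -/
lemma exact_of_forall_evaluation {J A : Type*} [Category J] [Category A] [Abelian A]
    (S : ShortComplex (J ⥤ A)) (h : ∀ X, (S.map ((evaluation J A).obj X)).Exact) : S.Exact := by
  rw [ShortComplex.exact_iff_isZero_homology, Functor.isZero_iff]
  intro X
  exact ((ShortComplex.exact_iff_isZero_homology _).1 (h X)).of_iso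
    (S.mapHomologyIso ((evaluation J A).obj X)).symm

lemma shortExact_of_forall_evaluation {J A : Type*} [Category J] [Category A] [Abelian A]
    (S : ShortComplex (J ⥤ A))
    (h : ∀ X, (S.map ((evaluation J A).obj X)).ShortExact) : S.ShortExact where
  exact := exact_of_forall_evaluation _ fun X => (h X).exact
  mono_f := by
    rw [NatTrans.mono_iff_mono_app]
    exact fun X => (h X).mono_f
  epi_g := by
    rw [NatTrans.epi_iff_epi_app]
    exact fun X => (h X).epi_g

lemma ShortExact.evaluation {S : ShortComplex (C ⥤ AddCommGrpCat.{u})} (h : S.ShortExact) (X : C) :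
    (S.map ((evaluation C AddCommGrpCat.{u}).obj X)).ShortExact :=
  h.map_of_exact _

/-- The free abelian group functor applied to the values of `Q`. -/
def lin (Q : C ⥤ Type u) : C ⥤ AddCommGrpCat.{u} :=
  Q ⋙ AddCommGrpCat.free

lemma lin_hom_ext {Q : C ⥤ Type u} {N : C ⥤ AddCommGrpCat.{u}} {f g : lin Q ⟶ N}
    (h : ∀ X (x : Q.obj X), (f.app X).hom (FreeAbelianGroup.of x) =
      (g.app X).hom (FreeAbelianGroup.of x)) : f = g := by
  ext X : 3
  exact FreeAbelianGroup.lift_ext _ _ (h X)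

/-- The morphism out of `lin Q` given by a natural family of maps. -/
def linDesc {Q : C ⥤ Type u} {N : C ⥤ AddCommGrpCat.{u}} (φ : ∀ X, Q.obj X → N.obj X)
    (hφ : ∀ {X Y : C} (f : X ⟶ Y) (x : Q.obj X), φ Y (Q.map f x) = N.map f (φ X x)) :
    lin Q ⟶ N where
  app X := AddCommGrpCat.ofHom (FreeAbelianGroup.lift (φ X))
  naturality X Y f := by
    ext1
    refine FreeAbelianGroup.lift_ext _ _ fun x => ?_
    change FreeAbelianGroup.lift (φ Y) (FreeAbelianGroup.map (Q.map f) (FreeAbelianGroup.of x)) =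
      (N.map f).hom (FreeAbelianGroup.lift (φ X) (FreeAbelianGroup.of x))
    rw [FreeAbelianGroup.map_of_apply, FreeAbelianGroup.lift_apply_of,
      FreeAbelianGroup.lift_apply_of]
    exact hφ f x

@[simp]
lemma linDesc_app_of {Q : C ⥤ Type u} {N : C ⥤ AddCommGrpCat.{u}} (φ : ∀ X, Q.obj X → N.obj X)
    (hφ : ∀ {X Y : C} (f : X ⟶ Y) (x : Q.obj X), φ Y (Q.map f x) = N.map f (φ X x)) (X : C)
    (x : Q.obj X) : ((linDesc φ hφ).app X).hom (FreeAbelianGroup.of x) = φ X x :=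
  FreeAbelianGroup.lift_apply_of _ _

@[simp]
lemma lin_map_of (Q : C ⥤ Type u) {X Y : C} (f : X ⟶ Y) (x : Q.obj X) :
    ((lin Q).map f).hom (FreeAbelianGroup.of x) = FreeAbelianGroup.of (Q.map f x) :=
  FreeAbelianGroup.map_of_apply _

/-- The disjoint union of the functors represented by the `Y`, one for each element of `M Y`. -/
def presentingSets (M : C ⥤ AddCommGrpCat.{u}) : C ⥤ Type u where
  obj X := Σ Y : C, (Y ⟶ X) × M.obj Y
  map f := TypeCat.ofHom fun x => ⟨x.1, x.2.1 ≫ f, x.2.2⟩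
  map_id X := by ext x <;> simp
  map_comp f g := by ext x <;> simp

/-- By Yoneda, a map out of this free module is freely determined by the images of the universal
elements `(Y, 𝟙 Y, m)`; lifting these along a pointwise surjection lifts the map. -/
lemma projective_lin_presentingSets (M : C ⥤ AddCommGrpCat.{u}) :
    Projective (lin (presentingSets M)) where
  factors {N N'} f e he := by
    have hs : ∀ Y, Function.Surjective ((e.app Y).hom) := fun Y => by
      rw [← AddCommGrpCat.epi_iff_surjective]
      infer_instance
    choose s hs using fun (Y : C) (m : M.obj Y) =>
      hs Y ((f.app Y).hom (FreeAbelianGroup.of (⟨Y, 𝟙 Y, m⟩ : (presentingSets M).obj Y)))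
    refine ⟨linDesc (fun X x => N.map x.2.1 (s x.1 x.2.2)) ?_, ?_⟩
    · intro X Y g x
      exact (congrArg (fun k => k.hom (s x.1 x.2.2)) (N.map_comp x.2.1 g))
    · refine lin_hom_ext fun X ⟨Y, h, m⟩ => ?_
      have h1 := NatTrans.naturality_apply e h (s Y m)
      have h2 := NatTrans.naturality_apply f h
        (FreeAbelianGroup.of (⟨Y, 𝟙 Y, m⟩ : (presentingSets M).obj Y))
      have h3 := lin_map_of (presentingSets M) h ⟨Y, 𝟙 Y, m⟩
      have h4 : (presentingSets M).map h ⟨Y, 𝟙 Y, m⟩ = ⟨Y, h, m⟩ := by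
        exact Sigma.ext rfl (heq_of_eq (Prod.ext (Category.id_comp h) rfl))
      rw [h4] at h3
      refine (congrArg (e.app X).hom (linDesc_app_of _ _ _ _)).trans ?_
      refine h1.trans ((congrArg (N'.map h).hom (hs Y m)).trans ?_)
      exact h2.symm.trans (congrArg (f.app X).hom h3)

lemma presentingMap_natural (M : C ⥤ AddCommGrpCat.{u}) {X Y : C} (f : X ⟶ Y)
    (x : (presentingSets M).obj X) :
    M.map ((presentingSets M).map f x).2.1 ((presentingSets M).map f x).2.2 =
      M.map f (M.map x.2.1 x.2.2) :=
  congrArg (fun k => k.hom x.2.2) (M.map_comp x.2.1 f)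

/-- The tautological epimorphism onto `M`. -/
def presentingMap (M : C ⥤ AddCommGrpCat.{u}) : lin (presentingSets M) ⟶ M :=
  linDesc (fun _ x => M.map x.2.1 x.2.2) (presentingMap_natural M)

instance (M : C ⥤ AddCommGrpCat.{u}) : Epi (presentingMap M) := by
  rw [NatTrans.epi_iff_epi_app]
  intro X
  rw [AddCommGrpCat.epi_iff_surjective]
  intro m
  refine ⟨FreeAbelianGroup.of (⟨X, 𝟙 X, m⟩ : (presentingSets M).obj X), ?_⟩
  exact (linDesc_app_of _ (presentingMap_natural M) _ _).trans
    (congrArg (fun k => k.hom m) (M.map_id X))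

instance : EnoughProjectives (C ⥤ AddCommGrpCat.{u}) where
  presentation M := ⟨{ p := lin (presentingSets M)
                       projective := projective_lin_presentingSets M
                       f := presentingMap M }⟩

end FunctorModules

/-! ### Coproducts of resolutions. -/

section Coproducts

open Limits

variable {A : Type*} [Category A] [Abelian A]

/-- The family is one short exact sequence of diagrams on a discrete category, to which the exact
functor `colim` applies. -/
lemma shortExact_coproduct {J : Type*} [HasColimitsOfShape (Discrete J) A]
    [HasExactColimitsOfShape (Discrete J) A] (S : J → ShortComplex A)
    (hS : ∀ j, (S j).ShortExact) :
    (ShortComplex.mk (Limits.Sigma.map fun j => (S j).f) (Limits.Sigma.map fun j => (S j).g)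
      (Limits.Sigma.hom_ext _ _ fun j => by simp)).ShortExact := by
  let U : ShortComplex (Discrete J ⥤ A) :=
    { X₁ := Discrete.functor fun j => (S j).X₁
      X₂ := Discrete.functor fun j => (S j).X₂
      X₃ := Discrete.functor fun j => (S j).X₃
      f := Discrete.natTrans fun j => (S j.as).f
      g := Discrete.natTrans fun j => (S j.as).g
      zero := by
        ext j
        exact (S j.as).zero }
  have hU : U.ShortExact := shortExact_of_forall_evaluation _ fun j => hS j.as
  exact hU.map_of_exact colim

lemma Res.coproduct {P : A → Prop} {J : Type*} [HasColimitsOfShape (Discrete J) A]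
    [HasExactColimitsOfShape (Discrete J) A] (hJ : ∀ M : J → A, (∀ j, P (M j)) → P (∐ M))
    {n : ℕ} (M : J → A) (hM : ∀ j, Res P n (M j)) : Res P n (∐ M) := by
  induction n generalizing M with
  | zero => exact hJ M hM
  | succ n ih =>
    choose S hS h₂ h₁ e using hM
    exact ⟨_, shortExact_coproduct S hS, hJ _ h₂, ih _ h₁, ⟨Limits.Sigma.mapIso fun j => (e j).some⟩⟩

end Coproducts

/-! ### The tensor product in both variables and its Hom adjunctions. -/

section TensorBifunctor

open Limits

variable {G : Type u} [Group G] {F : Set (Subgroup G)}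

open Classical in
/-- The class of `m ⊗ n` in `M ⊗_F N`. -/
noncomputable def tmk {M : RightModule F} {N : LeftModule F} (X : OrbitCat F) (m : M.obj (op X)) (n : N.obj X) :
    Tensor M N :=
  QuotientAddGroup.mk (DirectSum.of (fun X => (M.obj (op X)) ⊗[ℤ] (N.obj X)) X (m ⊗ₜ[ℤ] n))

lemma tensor_ext {M : RightModule F} {N : LeftModule F} {A : Type*} [AddCommGroup A]
    {f g : Tensor M N →+ A} (h : ∀ X (m : M.obj (op X)) (n : N.obj X),
      f (tmk X m n) = g (tmk X m n)) : f = g :=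
  tensor_hom_ext h

lemma tensorMap_tmk (M : RightModule F) {N N' : LeftModule F} (g : N ⟶ N') (X : OrbitCat F)
    (m : M.obj (op X)) (n : N.obj X) :
    tensorMap M g (tmk X m n) = tmk X m (g.app X n) :=
  tensorMap_of M g X m n

lemma tmk_balanced {M : RightModule F} {N : LeftModule F} {X Y : OrbitCat F} (φ : X ⟶ Y)
    (m : M.obj (op Y)) (n : N.obj X) :
    (tmk X (M.map φ.op m) n : Tensor M N) = tmk Y m (N.map φ n) := by
  rw [tmk, tmk, ← sub_eq_zero, ← QuotientAddGroup.mk_sub, QuotientAddGroup.eq_zero_iff]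
  exact AddSubgroup.subset_closure ⟨X, Y, φ, m, n, rfl⟩

/-- The biadditive map `(m, n) ↦ m ⊗ n`. -/
noncomputable def tmkHom (M : RightModule F) (N : LeftModule F) (X : OrbitCat F) :
    M.obj (op X) →+ N.obj X →+ Tensor M N where
  toFun m :=
    { toFun := fun n => tmk X m n
      map_zero' := by simp [tmk]
      map_add' := fun n n' => by simp [tmk, TensorProduct.tmul_add] }
  map_zero' := by ext; simp [tmk]
  map_add' m m' := by ext; simp [tmk, TensorProduct.add_tmul]

open Classical in
/-- The universal property of `M ⊗_F N`. -/
noncomputable def tensorLift {M : RightModule F} {N : LeftModule F} {A : Type*} [AddCommGroup A]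
    (φ : ∀ X : OrbitCat F, M.obj (op X) →+ N.obj X →+ A)
    (hφ : ∀ (X Y : OrbitCat F) (f : X ⟶ Y) (m : M.obj (op Y)) (n : N.obj X),
      φ X (M.map f.op m) n = φ Y m (N.map f n)) : Tensor M N →+ A :=
  QuotientAddGroup.lift (tensorRel M N)
    (DirectSum.toAddMonoid fun X => TensorProduct.liftAddHom (φ X) (fun r m n => by simp))
    (by
      rw [tensorRel, AddSubgroup.closure_le]
      rintro _ ⟨X, Y, f, m, n, rfl⟩
      simp [hφ])

@[simp]
lemma tensorLift_tmk {M : RightModule F} {N : LeftModule F} {A : Type*} [AddCommGroup A]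
    (φ : ∀ X : OrbitCat F, M.obj (op X) →+ N.obj X →+ A)
    (hφ : ∀ (X Y : OrbitCat F) (f : X ⟶ Y) (m : M.obj (op Y)) (n : N.obj X),
      φ X (M.map f.op m) n = φ Y m (N.map f n)) (X : OrbitCat F) (m : M.obj (op X))
    (n : N.obj X) : tensorLift φ hφ (tmk X m n) = φ X m n := by
  classical
  rw [tmk, tensorLift, QuotientAddGroup.lift_mk, DirectSum.toAddMonoid_of]
  rfl

/-- The map `M ⊗_F N → M' ⊗_F N` induced by a morphism `f : M ⟶ M'`. -/
noncomputable def tensorMapLeft {M M' : RightModule F} (f : M ⟶ M') (N : LeftModule F) :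
    Tensor M N →+ Tensor M' N :=
  tensorLift (fun X => (tmkHom M' N X).comp (f.app (op X)).hom) (by
    intro X Y φ m n
    have := NatTrans.naturality_apply f φ.op m
    exact (congrArg (fun m' => tmk X m' n) this).trans (tmk_balanced φ _ n))

@[simp]
lemma tensorMapLeft_tmk {M M' : RightModule F} (f : M ⟶ M') (N : LeftModule F) (X : OrbitCat F)
    (m : M.obj (op X)) (n : N.obj X) :
    tensorMapLeft f N (tmk X m n) = tmk X (f.app (op X) m) n :=
  tensorLift_tmk _ _ _ _ _

lemma tensorMapLeft_tensorMap {M M' : RightModule F} (f : M ⟶ M') {N N' : LeftModule F}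
    (g : N ⟶ N') (x : Tensor M N) :
    tensorMapLeft f N' (tensorMap M g x) = tensorMap M' g (tensorMapLeft f N x) := by
  have : (tensorMapLeft f N').comp (tensorMap M g) =
      (tensorMap M' g).comp (tensorMapLeft f N) :=
    tensor_ext fun X m n => by simp [tensorMap_tmk]
  exact DFunLike.congr_fun this x

/-- The functor `- ⊗_F N`. -/
noncomputable def tensorFlip (N : LeftModule F) : RightModule F ⥤ AddCommGrpCat.{u} where
  obj M := AddCommGrpCat.of (Tensor M N)
  map f := AddCommGrpCat.ofHom (tensorMapLeft f N)
  map_id M := by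
    ext1
    exact tensor_ext fun X m n => by simp
  map_comp f g := by
    ext1
    exact tensor_ext fun X m n => by simp

/-- The natural transformation `- ⊗_F N ⟶ - ⊗_F N'` induced by `g : N ⟶ N'`. -/
noncomputable def tensorFlipMap {N N' : LeftModule F} (g : N ⟶ N') : tensorFlip N ⟶ tensorFlip N' where
  app M := AddCommGrpCat.ofHom (tensorMap M g)
  naturality M M' f := by
    ext x
    exact (tensorMapLeft_tensorMap f g x).symm

/-- The morphism `M ⟶ Hom(N, A)` given by a homomorphism out of `M ⊗_F N`. -/
noncomputable def tensorCurry {M : RightModule F} {N : LeftModule F} {A : AddCommGrpCat.{u}}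
    (f : Tensor M N →+ A) : M ⟶ N.op ⋙ preadditiveYoneda.obj A where
  app X := AddCommGrpCat.ofHom
    { toFun := fun m => AddCommGrpCat.ofHom (f.comp (tmkHom M N X.unop m))
      map_zero' := AddCommGrpCat.hom_ext (AddMonoidHom.ext fun n => by simp; rfl)
      map_add' := fun m m' =>
        AddCommGrpCat.hom_ext (AddMonoidHom.ext fun n => by simp; rfl) }
  naturality X Y φ := AddCommGrpCat.hom_ext (AddMonoidHom.ext fun m =>
    AddCommGrpCat.hom_ext (AddMonoidHom.ext fun n =>
      congrArg f (tmk_balanced φ.unop m n)))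

/-- The homomorphism out of `M ⊗_F N` given by a morphism `M ⟶ Hom(N, A)`. -/
noncomputable def tensorUncurry {M : RightModule F} {N : LeftModule F} {A : AddCommGrpCat.{u}}
    (f : M ⟶ N.op ⋙ preadditiveYoneda.obj A) : Tensor M N →+ A :=
  tensorLift
    (fun X =>
      { toFun := fun m => ((f.app (op X)).hom m).hom
        map_zero' := AddMonoidHom.ext fun n => by rw [map_zero]; rfl
        map_add' := fun m m' => AddMonoidHom.ext fun n => by rw [map_add]; rfl })
    (fun X Y φ m n =>
      congrArg (fun k => k.hom n) (NatTrans.naturality_apply f φ.op m))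

lemma tensorUncurry_tmk {M : RightModule F} {N : LeftModule F} {A : AddCommGrpCat.{u}}
    (f : M ⟶ N.op ⋙ preadditiveYoneda.obj A) (X : OrbitCat F) (m : M.obj (op X)) (n : N.obj X) :
    tensorUncurry f (tmk X m n) = ((f.app (op X)).hom m).hom n :=
  tensorLift_tmk _ _ _ _ _

lemma tensorUncurry_tensorCurry {M : RightModule F} {N : LeftModule F} {A : AddCommGrpCat.{u}}
    (f : Tensor M N →+ A) : tensorUncurry (tensorCurry f) = f :=
  tensor_ext fun X m n => tensorUncurry_tmk _ X m n

lemma tensorCurry_tensorUncurry {M : RightModule F} {N : LeftModule F} {A : AddCommGrpCat.{u}}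
    (f : M ⟶ N.op ⋙ preadditiveYoneda.obj A) : tensorCurry (tensorUncurry f) = f := by
  refine NatTrans.ext (funext fun X => AddCommGrpCat.hom_ext (AddMonoidHom.ext fun m => ?_))
  exact AddCommGrpCat.hom_ext (AddMonoidHom.ext fun n => tensorUncurry_tmk f X.unop m n)

lemma tensorUncurry_comp {M M' : RightModule F} {N : LeftModule F} {A : AddCommGrpCat.{u}}
    (g : M ⟶ M') (f : M' ⟶ N.op ⋙ preadditiveYoneda.obj A) :
    tensorUncurry (g ≫ f) = (tensorUncurry f).comp (tensorMapLeft g N) := by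
  refine tensor_ext fun X m n => ?_
  rw [AddMonoidHom.comp_apply, tensorMapLeft_tmk, tensorUncurry_tmk, tensorUncurry_tmk]
  rfl

/-- `- ⊗_F N` is left adjoint to taking `Hom(N, -)`. -/
noncomputable def tensorFlipAdj (N : LeftModule F) :
    tensorFlip N ⊣ preadditiveYoneda ⋙ (Functor.whiskeringLeft _ _ _).obj N.op :=
  Adjunction.mkOfHomEquiv
    { homEquiv := fun _ _ =>
        { toFun := fun f => tensorCurry f.hom
          invFun := fun f => AddCommGrpCat.ofHom (tensorUncurry f)
          left_inv := fun f => AddCommGrpCat.hom_ext (tensorUncurry_tensorCurry f.hom)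
          right_inv := fun f => tensorCurry_tensorUncurry f }
      homEquiv_naturality_left_symm := fun f g =>
        AddCommGrpCat.hom_ext (tensorUncurry_comp f g)
      homEquiv_naturality_right := fun _ _ => rfl }

/-- The morphism `N ⟶ Hom(M, A)` given by a homomorphism out of `M ⊗_F N`. -/
noncomputable def tensorCurry' {M : RightModule F} {N : LeftModule F} {A : AddCommGrpCat.{u}}
    (f : Tensor M N →+ A) : N ⟶ M.rightOp ⋙ preadditiveYoneda.obj A where
  app X := AddCommGrpCat.ofHom
    { toFun := fun n => AddCommGrpCat.ofHom (f.comp ((tmkHom M N X).flip n))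
      map_zero' := AddCommGrpCat.hom_ext (AddMonoidHom.ext fun m => by simp; rfl)
      map_add' := fun n n' =>
        AddCommGrpCat.hom_ext (AddMonoidHom.ext fun m => by simp; rfl) }
  naturality X Y φ := AddCommGrpCat.hom_ext (AddMonoidHom.ext fun n =>
    AddCommGrpCat.hom_ext (AddMonoidHom.ext fun m =>
      congrArg f (tmk_balanced φ m n).symm))

/-- The homomorphism out of `M ⊗_F N` given by a morphism `N ⟶ Hom(M, A)`. -/
noncomputable def tensorUncurry' {M : RightModule F} {N : LeftModule F} {A : AddCommGrpCat.{u}}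
    (f : N ⟶ M.rightOp ⋙ preadditiveYoneda.obj A) : Tensor M N →+ A :=
  tensorLift
    (fun X => AddMonoidHom.flip
      { toFun := fun n => ((f.app X).hom n).hom
        map_zero' := AddMonoidHom.ext fun m => by rw [map_zero]; rfl
        map_add' := fun n n' => AddMonoidHom.ext fun m => by rw [map_add]; rfl })
    (fun X Y φ m n =>
      congrArg (fun k => k.hom m) (NatTrans.naturality_apply f φ n).symm)

lemma tensorUncurry'_tmk {M : RightModule F} {N : LeftModule F} {A : AddCommGrpCat.{u}}
    (f : N ⟶ M.rightOp ⋙ preadditiveYoneda.obj A) (X : OrbitCat F) (m : M.obj (op X)) (n : N.obj X) :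
    tensorUncurry' f (tmk X m n) = ((f.app X).hom n).hom m :=
  tensorLift_tmk _ _ _ _ _

lemma tensorUncurry'_tensorCurry' {M : RightModule F} {N : LeftModule F} {A : AddCommGrpCat.{u}}
    (f : Tensor M N →+ A) : tensorUncurry' (tensorCurry' f) = f :=
  tensor_ext fun X m n => tensorUncurry'_tmk _ X m n

lemma tensorCurry'_tensorUncurry' {M : RightModule F} {N : LeftModule F} {A : AddCommGrpCat.{u}}
    (f : N ⟶ M.rightOp ⋙ preadditiveYoneda.obj A) : tensorCurry' (tensorUncurry' f) = f := by
  refine NatTrans.ext (funext fun X => AddCommGrpCat.hom_ext (AddMonoidHom.ext fun n => ?_))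
  exact AddCommGrpCat.hom_ext (AddMonoidHom.ext fun m => tensorUncurry'_tmk f X m n)

lemma tensorUncurry'_comp {M : RightModule F} {N N' : LeftModule F} {A : AddCommGrpCat.{u}}
    (g : N ⟶ N') (f : N' ⟶ M.rightOp ⋙ preadditiveYoneda.obj A) :
    tensorUncurry' (g ≫ f) = (tensorUncurry' f).comp (tensorMap M g) := by
  refine tensor_ext fun X m n => ?_
  rw [AddMonoidHom.comp_apply, tensorMap_tmk, tensorUncurry'_tmk, tensorUncurry'_tmk]
  rfl

/-- `M ⊗_F -` is left adjoint to taking `Hom(M, -)`. -/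
noncomputable def tensorFunctorAdj (M : RightModule F) :
    tensorFunctor M ⊣ preadditiveYoneda ⋙ (Functor.whiskeringLeft _ _ _).obj M.rightOp :=
  Adjunction.mkOfHomEquiv
    { homEquiv := fun _ _ =>
        { toFun := fun f => tensorCurry' f.hom
          invFun := fun f => AddCommGrpCat.ofHom (tensorUncurry' f)
          left_inv := fun f => AddCommGrpCat.hom_ext (tensorUncurry'_tensorCurry' f.hom)
          right_inv := fun f => tensorCurry'_tensorUncurry' f }
      homEquiv_naturality_left_symm := fun f g =>
        AddCommGrpCat.hom_ext (tensorUncurry'_comp f g)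
      homEquiv_naturality_right := fun _ _ => rfl }

end TensorBifunctor

/-! ### Flatness as a lifting property. -/

section LiftFlat

open Limits

variable {C : Type u} [SmallCategory C]

/-- The restriction `Hom(N', A) ⟶ Hom(N, A)` along `i : N ⟶ N'`. -/
abbrev dualMap {N N' : C ⥤ AddCommGrpCat.{u}} (i : N ⟶ N') (A : AddCommGrpCat.{u}) :
    N'.op ⋙ preadditiveYoneda.obj A ⟶ N.op ⋙ preadditiveYoneda.obj A :=
  Functor.whiskerRight (NatTrans.op i) (preadditiveYoneda.obj A)

/-- Flatness in terms of morphisms into duals: morphisms into `Hom(N, A)`, with `A` injective,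
lift along the restriction from `Hom(N', A)` whenever `N` is a submodule of `N'`. -/
def LiftFlat (M : Cᵒᵖ ⥤ AddCommGrpCat.{u}) : Prop :=
  ∀ ⦃N N' : C ⥤ AddCommGrpCat.{u}⦄ (i : N ⟶ N'), Mono i → ∀ A : AddCommGrpCat.{u}, Injective A →
    ∀ f : M ⟶ N.op ⋙ preadditiveYoneda.obj A, ∃ f', f' ≫ dualMap i A = f

lemma epi_dualMap {N N' : C ⥤ AddCommGrpCat.{u}} (i : N ⟶ N') [Mono i] (A : AddCommGrpCat.{u})
    [Injective A] : Epi (dualMap i A) := by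
  rw [NatTrans.epi_iff_epi_app]
  intro X
  rw [AddCommGrpCat.epi_iff_surjective]
  intro h
  have : Mono (i.app X.unop) := (NatTrans.mono_iff_mono_app i).1 inferInstance X.unop
  exact ⟨Injective.factorThru h (i.app X.unop), Injective.comp_factorThru h (i.app X.unop)⟩

lemma liftFlat_of_projective (M : Cᵒᵖ ⥤ AddCommGrpCat.{u}) [Projective M] : LiftFlat M :=
  fun N N' i _ A _ f => by
    have := epi_dualMap i A
    exact ⟨Projective.factorThru f (dualMap i A), Projective.factorThru_comp _ _⟩

/-- The adjunction transposes the lifting problem to `D`: restricting `Hom(N, A)` along `I` gives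
`Hom(I^* N, A)`, and restriction keeps monomorphisms. This is how induction is seen to preserve
flatness without computing tensor products. -/
lemma LiftFlat.map {D : Type u} [SmallCategory D] (I : D ⥤ C)
    {L : (Dᵒᵖ ⥤ AddCommGrpCat.{u}) ⥤ (Cᵒᵖ ⥤ AddCommGrpCat.{u})}
    (adj : L ⊣ (Functor.whiskeringLeft _ _ _).obj I.op) {M : Dᵒᵖ ⥤ AddCommGrpCat.{u}}
    (hM : LiftFlat M) : LiftFlat (L.obj M) := fun N N' i hi A hA f => by
  have : Mono (Functor.whiskerLeft I i) := by
    rw [NatTrans.mono_iff_mono_app]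
    exact fun X => (NatTrans.mono_iff_mono_app i).1 hi (I.obj X)
  obtain ⟨g, hg⟩ := hM (Functor.whiskerLeft I i) this A hA (adj.homEquiv _ _ f)
  refine ⟨(adj.homEquiv _ (N'.op ⋙ preadditiveYoneda.obj A)).symm g, ?_⟩
  rw [← Adjunction.homEquiv_naturality_right_symm, Equiv.symm_apply_eq]
  exact hg

end LiftFlat

/-! ### Flat dimension and vanishing of torsion. -/

section Flat

open Limits

variable {G : Type u} [Group G] {F : Set (Subgroup G)}

instance (M : RightModule F) : (tensorFunctor M).Additive where
  map_add {_ N' f g} := AddCommGrpCat.hom_ext (tensor_ext fun X m n =>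
    (tensorMap_tmk M (f + g) X m n).trans ((map_add (tmkHom M N' X m) _ _).trans
      (congrArg₂ (· + ·) (tensorMap_tmk M f X m n).symm (tensorMap_tmk M g X m n).symm)))

/-- Right exactness, because a left adjoint preserves colimits. -/
lemma exact_and_epi_tensorFunctor (M : RightModule F) {S : ShortComplex (LeftModule F)}
    (hS : S.ShortExact) :
    (S.map (tensorFunctor M)).Exact ∧ Epi ((tensorFunctor M).map S.g) := by
  have := (tensorFunctorAdj M).leftAdjoint_preservesColimits
  exact ((tensorFunctor M).preservesFiniteColimits_iff_forall_exact_map_and_epi).1 inferInstance S hS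

instance (N : LeftModule F) : (tensorFlip N).Additive where
  map_add {_ M' f g} := AddCommGrpCat.hom_ext (tensor_ext fun X m n =>
    (tensorMapLeft_tmk (f + g) N X m n).trans
      ((DFunLike.congr_fun (map_add (tmkHom M' N X) (f.app (op X) m) (g.app (op X) m)) n).trans
      (congrArg₂ (· + ·) (tensorMapLeft_tmk f N X m n).symm (tensorMapLeft_tmk g N X m n).symm)))

lemma exact_and_epi_tensorFlip (N : LeftModule F) {S : ShortComplex (RightModule F)}
    (hS : S.ShortExact) :
    (S.map (tensorFlip N)).Exact ∧ Epi ((tensorFlip N).map S.g) := by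
  have := (tensorFlipAdj N).leftAdjoint_preservesColimits
  exact ((tensorFlip N).preservesFiniteColimits_iff_forall_exact_map_and_epi).1 inferInstance S hS

lemma tensorMap_surjective (M : RightModule F) {S : ShortComplex (LeftModule F)}
    (hS : S.ShortExact) : Function.Surjective (tensorMap M S.g) :=
  (AddCommGrpCat.epi_iff_surjective _).1 (exact_and_epi_tensorFunctor M hS).2

lemma tensorMap_exact (M : RightModule F) {S : ShortComplex (LeftModule F)}
    (hS : S.ShortExact) (x : Tensor M S.X₂) (hx : tensorMap M S.g x = 0) :
    ∃ y, tensorMap M S.f y = x :=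
  (ShortComplex.ab_exact_iff _).1 (exact_and_epi_tensorFunctor M hS).1 x hx

lemma tensorMap_comp_zero (M : RightModule F) (S : ShortComplex (LeftModule F))
    (x : Tensor M S.X₁) : tensorMap M S.g (tensorMap M S.f x) = 0 :=
  congrArg (fun k => k.hom x) (S.map (tensorFunctor M)).zero

lemma tensorMapLeft_surjective (N : LeftModule F) {S : ShortComplex (RightModule F)}
    (hS : S.ShortExact) : Function.Surjective (tensorMapLeft S.g N) :=
  (AddCommGrpCat.epi_iff_surjective _).1 (exact_and_epi_tensorFlip N hS).2

lemma tensorMapLeft_exact (N : LeftModule F) {S : ShortComplex (RightModule F)}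
    (hS : S.ShortExact) (x : Tensor S.X₂ N) (hx : tensorMapLeft S.g N x = 0) :
    ∃ y, tensorMapLeft S.f N y = x :=
  (ShortComplex.ab_exact_iff _).1 (exact_and_epi_tensorFlip N hS).1 x hx

lemma tensorMapLeft_comp_zero (N : LeftModule F) (S : ShortComplex (RightModule F))
    (x : Tensor S.X₁ N) : tensorMapLeft S.g N (tensorMapLeft S.f N x) = 0 :=
  congrArg (fun k => k.hom x) (S.map (tensorFlip N)).zero

lemma tensorMap_comp (M : RightModule F) {N N' N'' : LeftModule F} (g : N ⟶ N') (h : N' ⟶ N'')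
    (x : Tensor M N) : tensorMap M (g ≫ h) x = tensorMap M h (tensorMap M g x) :=
  congrArg (fun k => k.hom x) ((tensorFunctor M).map_comp g h)

lemma isFlat_of_injective (M : RightModule F)
    (h : ∀ S : ShortComplex (LeftModule F), S.ShortExact → Function.Injective (tensorMap M S.f)) :
    IsFlat M := fun S hS =>
  { exact := (exact_and_epi_tensorFunctor M hS).1
    mono_f := (AddCommGrpCat.mono_iff_injective _).2 (h S hS)
    epi_g := (exact_and_epi_tensorFunctor M hS).2 }

lemma IsFlat.injective {M : RightModule F} (hM : IsFlat M) {S : ShortComplex (LeftModule F)}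
    (hS : S.ShortExact) : Function.Injective (tensorMap M S.f) :=
  (AddCommGrpCat.mono_iff_injective _).1 (hM S hS).mono_f

/-- Extend an embedding of `B` into an injective group along `f`: since the composite is injective,
so is `f`. -/
lemma injective_of_forall_extension {B B' : Type u} [AddCommGroup B] [AddCommGroup B']
    (f : B →+ B') (h : ∀ A : AddCommGrpCat.{u}, Injective A → ∀ g : B →+ A, ∃ g' : B' →+ A,
      g'.comp f = g) : Function.Injective f := by
  obtain ⟨g', hg'⟩ := h (Injective.under (AddCommGrpCat.of B)) inferInstance
    (Injective.ι (AddCommGrpCat.of B)).hom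
  have h1 : Function.Injective (Injective.ι (AddCommGrpCat.of B)).hom :=
    (AddCommGrpCat.mono_iff_injective _).1 inferInstance
  rw [← hg'] at h1
  exact Function.Injective.of_comp h1

/-- Under `Hom(M ⊗ N, A) = Hom(M, Hom(N, A))`, the lifting property says that homomorphisms from `M
⊗ N` to injective groups extend to `M ⊗ N'`, which is injectivity of `M ⊗ N → M ⊗ N'`. -/
lemma isFlat_iff_liftFlat (M : RightModule F) : IsFlat M ↔ LiftFlat M := by
  constructor
  · intro hM N N' i hi A hA f
    have hS : (ShortComplex.mk i (cokernel.π i) (by simp)).ShortExact :=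
      { exact := ShortComplex.exact_cokernel _ }
    have hm : Mono (AddCommGrpCat.ofHom (tensorMap M i)) :=
      (AddCommGrpCat.mono_iff_injective _).2 (hM.injective hS)
    let g := Injective.factorThru (AddCommGrpCat.ofHom (tensorUncurry f))
      (AddCommGrpCat.ofHom (tensorMap M i))
    have hg : g.hom.comp (tensorMap M i) = tensorUncurry f :=
      congrArg AddCommGrpCat.Hom.hom (Injective.comp_factorThru
        (AddCommGrpCat.ofHom (tensorUncurry f)) (AddCommGrpCat.ofHom (tensorMap M i)))
    refine ⟨tensorCurry g.hom, ?_⟩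
    rw [← tensorCurry_tensorUncurry f, ← hg]
    refine NatTrans.ext (funext fun X => AddCommGrpCat.hom_ext (AddMonoidHom.ext fun m => ?_))
    exact AddCommGrpCat.hom_ext (AddMonoidHom.ext fun n =>
      congrArg g.hom (tensorMap_tmk M i X.unop m n).symm)
  · intro hM
    refine isFlat_of_injective M fun S hS => injective_of_forall_extension _ fun A hA g => ?_
    obtain ⟨f', hf'⟩ := hM S.f hS.mono_f A hA (tensorCurry g)
    refine ⟨tensorUncurry f', ?_⟩
    rw [← tensorUncurry_tensorCurry g, ← hf']
    refine tensor_ext fun X m n => ?_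
    rw [AddMonoidHom.comp_apply, tensorMap_tmk, tensorUncurry_tmk, tensorUncurry_tmk]
    rfl

lemma isFlat_of_projective (M : RightModule F) [Projective M] : IsFlat M :=
  (isFlat_iff_liftFlat M).2 (liftFlat_of_projective M)

lemma isFlat_of_iso {M N : RightModule F} (e : M ≅ N) (hM : IsFlat M) : IsFlat N := by
  rw [isFlat_iff_liftFlat] at hM ⊢
  intro N₁ N₂ i hi A hA f
  obtain ⟨f', hf'⟩ := hM i hi A hA (e.hom ≫ f)
  exact ⟨e.inv ≫ f', by rw [Category.assoc, hf', e.inv_hom_id_assoc]⟩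

lemma isFlat_of_isZero (M : RightModule F) (hM : IsZero M) : IsFlat M := by
  rw [isFlat_iff_liftFlat]
  intro N₁ N₂ i hi A hA f
  exact ⟨0, hM.eq_of_src _ _⟩

lemma tensorMapLeft_injective_of_projective (Q : LeftModule F) [Projective Q] {K P : RightModule F}
    (f : K ⟶ P) [Mono f] : Function.Injective (tensorMapLeft f Q) := by
  refine injective_of_forall_extension _ fun A hA g => ?_
  let d : P.rightOp ⋙ preadditiveYoneda.obj A ⟶ K.rightOp ⋙ preadditiveYoneda.obj A :=
    Functor.whiskerRight (NatTrans.rightOp f) (preadditiveYoneda.obj A)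
  have hd : Epi d := by
    rw [NatTrans.epi_iff_epi_app]
    intro X
    rw [AddCommGrpCat.epi_iff_surjective]
    intro h
    have : Mono (f.app (op X)) := (NatTrans.mono_iff_mono_app f).1 inferInstance (op X)
    exact ⟨Injective.factorThru h (f.app (op X)), Injective.comp_factorThru h (f.app (op X))⟩
  obtain ⟨g', hg'⟩ : ∃ g', g' ≫ d = tensorCurry' g := ⟨_, Projective.factorThru_comp _ d⟩
  refine ⟨tensorUncurry' g', ?_⟩
  rw [← tensorUncurry'_tensorCurry' g, ← hg']
  refine tensor_ext fun X m n => ?_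
  rw [AddMonoidHom.comp_apply, tensorMapLeft_tmk, tensorUncurry'_tmk, tensorUncurry'_tmk]
  rfl

/-- `N` is an `n`-th syzygy of some left module. -/
def IsSyzygy : ℕ → LeftModule F → Prop
  | 0, _ => True
  | n + 1, N => ∃ S : ShortComplex (LeftModule F), S.ShortExact ∧ Projective S.X₂ ∧ S.X₁ = N ∧
      IsSyzygy n S.X₃

/-- The vanishing of the `(n + 1)`-st torsion groups of `M`: tensoring with `M` preserves the
injectivity of `N ⟶ Q` if `Q` is projective and the cokernel is an `n`-th syzygy. -/
def TorVanishes (n : ℕ) (M : RightModule F) : Prop :=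
  ∀ S : ShortComplex (LeftModule F), S.ShortExact → Projective S.X₂ → IsSyzygy n S.X₃ →
    Function.Injective (tensorMap M S.f)

/-- In effect, `Tor₁(M, C) = 0` may be tested on projective presentations of `C`. Cover `S.X₂` by a
projective `p : Q → S.X₂`. An element of `M ⊗ S.X₁` dying in `M ⊗ S.X₂` lifts to `M ⊗ ker (p ≫
S.g)`; in `M ⊗ Q` the lift agrees with an element of `M ⊗ ker p`, hence already does so in `M ⊗ ker
(p ≫ S.g)`, and it dies in `M ⊗ S.X₁`. -/
lemma tensorMap_injective_of_projective_presentations (M : RightModule F) (C : LeftModule F)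
    (h : ∀ S : ShortComplex (LeftModule F), S.ShortExact → Projective S.X₂ → S.X₃ = C →
      Function.Injective (tensorMap M S.f))
    {S : ShortComplex (LeftModule F)} (hS : S.ShortExact) (hC : S.X₃ = C) :
    Function.Injective (tensorMap M S.f) := by
  subst hC
  have := hS.epi_g
  have := hS.mono_f
  let p := Projective.π S.X₂
  have h₁ : (ShortComplex.mk (kernel.ι p) p (by simp)).ShortExact :=
    { exact := ShortComplex.exact_kernel _ }
  have h₂ : (ShortComplex.mk (kernel.ι (p ≫ S.g)) (p ≫ S.g) (by simp)).ShortExact :=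
    { exact := ShortComplex.exact_kernel _
      epi_g := epi_comp _ _ }
  let q : kernel (p ≫ S.g) ⟶ S.X₁ := hS.exact.lift (kernel.ι (p ≫ S.g) ≫ p) (by simp)
  have hq : q ≫ S.f = kernel.ι (p ≫ S.g) ≫ p := hS.exact.lift_f _ _
  let r : kernel p ⟶ kernel (p ≫ S.g) := kernel.lift _ (kernel.ι p) (by simp)
  have hr : r ≫ kernel.ι (p ≫ S.g) = kernel.ι p := kernel.lift_ι _ _ _
  have hrq : r ≫ q = 0 := by
    rw [← cancel_mono S.f, Category.assoc, hq, reassoc_of% hr]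
    simp
  -- The comparison sequence `0 → ker p → ker (p ≫ S.g) → S.X₁ → 0`.
  have h₃ : (ShortComplex.mk r q hrq).ShortExact :=
    { exact := by
        rw [ShortComplex.exact_iff_exact_up_to_refinements]
        intro A x hx
        have hx' : (x ≫ kernel.ι (p ≫ S.g)) ≫ p = 0 := by
          rw [Category.assoc, ← hq, reassoc_of% hx, zero_comp]
        refine ⟨A, 𝟙 A, inferInstance, kernel.lift p _ hx', ?_⟩
        have key : kernel.lift p _ hx' ≫ r ≫ kernel.ι (p ≫ S.g) = x ≫ kernel.ι (p ≫ S.g) := by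
          rw [hr, kernel.lift_ι]
        exact (Category.id_comp x).trans ((cancel_mono (kernel.ι (p ≫ S.g))).1
          (key.symm.trans (Category.assoc _ _ _).symm))
      mono_f := by
        have : Mono (r ≫ kernel.ι (p ≫ S.g)) := by
          rw [hr]
          infer_instance
        exact mono_of_mono r (kernel.ι (p ≫ S.g))
      epi_g := by
        refine (epi_iff_surjective_up_to_refinements q).2 fun A a => ?_
        obtain ⟨A', π, hπ, y, hy⟩ := surjective_up_to_refinements_of_epi p (a ≫ S.f)
        refine ⟨A', π, hπ, kernel.lift (p ≫ S.g) y ?_, ?_⟩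
        · rw [← reassoc_of% hy, S.zero, comp_zero, comp_zero]
        · rw [← cancel_mono S.f, Category.assoc, Category.assoc, hq, kernel.lift_ι_assoc, hy] }
  rw [injective_iff_map_eq_zero]
  intro x hx
  obtain ⟨y, rfl⟩ := tensorMap_surjective M h₃ x
  change tensorMap M S.f (tensorMap M q y) = 0 at hx
  rw [← tensorMap_comp, hq, tensorMap_comp] at hx
  obtain ⟨z, hz⟩ := tensorMap_exact M h₁ _ hx
  change tensorMap M (kernel.ι p) z = _ at hz
  rw [← hr, tensorMap_comp] at hz
  rw [← h _ h₂ inferInstance rfl hz]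
  exact tensorMap_comp_zero M (ShortComplex.mk r q hrq) z

lemma isFlat_of_torVanishes {M : RightModule F} (hM : TorVanishes 0 M) : IsFlat M :=
  isFlat_of_injective M fun S hS => tensorMap_injective_of_projective_presentations M S.X₃
    (fun T hT hP _ => hM T hT hP trivial) hS rfl

/-- A diagram chase in the 3 × 3 grid `R ⊗ S`. This lemma and the next, its mirror image, play the
part of the balancing of `Tor₁(R.X₃, S.X₃)`: each turns injectivity in one variable into injectivity
in the other. -/
lemma tensorMap_injective_of_shortExact {R : ShortComplex (RightModule F)} (hR : R.ShortExact)
    {S : ShortComplex (LeftModule F)} (hS : S.ShortExact)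
    (h₁ : Function.Injective (tensorMap R.X₂ S.f))
    (h₂ : Function.Injective (tensorMapLeft R.f S.X₃)) :
    Function.Injective (tensorMap R.X₃ S.f) := by
  rw [injective_iff_map_eq_zero]
  intro x hx
  obtain ⟨y, rfl⟩ := tensorMapLeft_surjective S.X₁ hR x
  rw [← tensorMapLeft_tensorMap] at hx
  obtain ⟨z, hz⟩ := tensorMapLeft_exact _ hR _ hx
  have hz' : tensorMap R.X₁ S.g z = 0 := by
    apply h₂
    rw [tensorMapLeft_tensorMap, hz, tensorMap_comp_zero, map_zero]
  obtain ⟨w, rfl⟩ := tensorMap_exact _ hS _ hz'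
  rw [tensorMapLeft_tensorMap] at hz
  rw [← h₁ hz, tensorMapLeft_comp_zero]

lemma tensorMapLeft_injective_of_shortExact {R : ShortComplex (RightModule F)}
    (hR : R.ShortExact) {S : ShortComplex (LeftModule F)} (hS : S.ShortExact)
    (h₁ : Function.Injective (tensorMapLeft R.f S.X₂))
    (h₂ : Function.Injective (tensorMap R.X₃ S.f)) :
    Function.Injective (tensorMapLeft R.f S.X₃) := by
  rw [injective_iff_map_eq_zero]
  intro x hx
  obtain ⟨y, rfl⟩ := tensorMap_surjective R.X₁ hS x
  rw [tensorMapLeft_tensorMap] at hx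
  obtain ⟨z, hz⟩ := tensorMap_exact _ hS _ hx
  have hz' : tensorMapLeft R.g S.X₁ z = 0 := by
    apply h₂
    rw [← tensorMapLeft_tensorMap, hz, tensorMapLeft_comp_zero, map_zero]
  obtain ⟨w, rfl⟩ := tensorMapLeft_exact _ hR _ hz'
  rw [← tensorMapLeft_tensorMap] at hz
  rw [← h₁ hz, tensorMap_comp_zero]

lemma torVanishes_of_iso {n : ℕ} {M N : RightModule F} (e : M ≅ N) (hM : TorVanishes n M) :
    TorVanishes n N := fun S hS hP hn => by
  have h1 : Function.LeftInverse (tensorMapLeft e.hom S.X₁) (tensorMapLeft e.inv S.X₁) :=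
    fun x => congrArg (fun k => k.hom x) ((tensorFlip S.X₁).mapIso e).inv_hom_id
  rw [injective_iff_map_eq_zero]
  intro x hx
  rw [← h1 x]
  have : tensorMapLeft e.inv S.X₁ x = 0 := by
    apply hM S hS hP hn
    rw [← tensorMapLeft_tensorMap, hx, map_zero, map_zero]
  rw [this, map_zero]

/-- Dimension shifting: one syzygy of `M` is exchanged for one syzygy of the left module. -/
lemma Res.torVanishes {n : ℕ} {M : RightModule F} (hM : Res IsFlat n M) : TorVanishes n M := by
  induction n generalizing M with
  | zero => exact fun S hS _ _ => IsFlat.injective hM hS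
  | succ n ih =>
    obtain ⟨R, hR, h₂, h₁, ⟨e⟩⟩ := hM
    refine torVanishes_of_iso e fun S hS _ ⟨T, hT, hT₂, hT₁, hT₃⟩ => ?_
    refine tensorMap_injective_of_shortExact hR hS (h₂.injective hS) ?_
    rw [← hT₁]
    have := hR.mono_f
    -- Going round the square the other way, the composite factors through `R.X₁ ⊗ T.X₂`: the first
    -- map is injective by induction, the second because `T.X₂` is projective.
    have h : Function.Injective ((tensorMap R.X₂ T.f).comp (tensorMapLeft R.f T.X₁)) := by
      have h' : (tensorMap R.X₂ T.f).comp (tensorMapLeft R.f T.X₁) =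
          (tensorMapLeft R.f T.X₂).comp (tensorMap R.X₁ T.f) :=
        AddMonoidHom.ext fun x => (tensorMapLeft_tensorMap R.f T.f x).symm
      rw [h']
      exact (tensorMapLeft_injective_of_projective T.X₂ R.f).comp (ih h₁ T hT hT₂ hT₃)
    exact Function.Injective.of_comp h

/-- The converse shift: if `S.X₃` is an `n`-th syzygy then `S.X₁` is the kernel one step further.
Vanishing for `M` on a presentation of `S.X₁` makes `ker π ⊗ S.X₁ → P ⊗ S.X₁` injective, where `π :
P → M` is the projective presentation of `M`; flatness of `P` then gives injectivity of `ker π ⊗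
S.X₁ → ker π ⊗ S.X₂`. -/
lemma res_of_torVanishes {n : ℕ} {M : RightModule F} (hM : TorVanishes n M) : Res IsFlat n M := by
  induction n generalizing M with
  | zero => exact isFlat_of_torVanishes hM
  | succ n ih =>
    have hR : (ShortComplex.mk (kernel.ι (Projective.π M)) (Projective.π M)
        (by simp)).ShortExact := { exact := ShortComplex.exact_kernel _ }
    refine ⟨_, hR, isFlat_of_projective _, ih fun S hS hP hn => ?_, ⟨Iso.refl _⟩⟩
    have hS' : (ShortComplex.mk (kernel.ι (Projective.π S.X₁)) (Projective.π S.X₁)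
        (by simp)).ShortExact := { exact := ShortComplex.exact_kernel _ }
    have h₁ := tensorMapLeft_injective_of_shortExact hR hS'
      (tensorMapLeft_injective_of_projective _ (kernel.ι (Projective.π M)))
      (hM _ hS' inferInstance ⟨S, hS, hP, rfl, hn⟩)
    have h : Function.Injective ((tensorMapLeft (kernel.ι (Projective.π M)) S.X₂).comp
        (tensorMap (kernel (Projective.π M)) S.f)) := by
      have h' : (tensorMapLeft (kernel.ι (Projective.π M)) S.X₂).comp
          (tensorMap (kernel (Projective.π M)) S.f) =
          (tensorMap _ S.f).comp (tensorMapLeft (kernel.ι (Projective.π M)) S.X₁) :=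
        AddMonoidHom.ext fun x => tensorMapLeft_tensorMap _ S.f x
      rw [h']
      exact ((isFlat_of_projective _).injective hS).comp h₁
    exact Function.Injective.of_comp h

/-- Tensoring commutes with colimits, and filtered colimits of injections of abelian groups are
injections. -/
lemma torVanishes_of_isColimit {J : Type u} [SmallCategory J] [IsFiltered J] {n : ℕ}
    {D : J ⥤ RightModule F} {c : Cocone D} (hc : IsColimit c) (hD : ∀ j, TorVanishes n (D.obj j)) :
    TorVanishes n c.pt := fun S hS hP hn => by
  refine (AddCommGrpCat.mono_iff_injective (AddCommGrpCat.ofHom (tensorMap c.pt S.f))).1 ?_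
  have := (tensorFlipAdj S.X₁).leftAdjoint_preservesColimits
  have := (tensorFlipAdj S.X₂).leftAdjoint_preservesColimits
  let φ : D ⋙ tensorFlip S.X₁ ⟶ D ⋙ tensorFlip S.X₂ := Functor.whiskerLeft D (tensorFlipMap S.f)
  have : Mono φ := by
    rw [NatTrans.mono_iff_mono_app]
    exact fun j => (AddCommGrpCat.mono_iff_injective _).2 (hD j S hS hP hn)
  exact colim.map_mono' φ (isColimitOfPreserves (tensorFlip S.X₁) hc)
    (isColimitOfPreserves (tensorFlip S.X₂) hc) _
    fun j => (tensorFlipMap S.f).naturality (c.ι.app j)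

end Flat

/-! ### Induction along a category of elements. -/

section Induction

open Limits

variable {C : Type u} [SmallCategory C]

/-- An element of a set-valued functor. -/
structure Elt (P : C ⥤ Type u) : Type u where
  base : C
  pt : P.obj base

variable {P : C ⥤ Type u}

instance : SmallCategory (Elt P) where
  Hom p q := { f : p.base ⟶ q.base // P.map f p.pt = q.pt }
  id p := ⟨𝟙 p.base, by simp⟩
  comp f g := ⟨f.1 ≫ g.1, by simp [f.2, g.2]⟩

variable (P) in
/-- The projection from the category of elements. -/
def eltProj : Elt P ⥤ C where
  obj p := p.base
  map f := f.1

/-- The inclusion of a summand into the value of the induced module. -/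
noncomputable def indι (M : Elt P ⥤ AddCommGrpCat.{u}) (p : Elt P) :
    M.obj p ⟶ ∐ fun x : P.obj p.base => M.obj ⟨p.base, x⟩ :=
  Limits.Sigma.ι (fun x : P.obj p.base => M.obj ⟨p.base, x⟩) p.pt

/-- The action of a morphism of `C` on the induced module. -/
noncomputable def indMap (M : Elt P ⥤ AddCommGrpCat.{u}) {X Y : C} (f : X ⟶ Y) :
    (∐ fun x : P.obj X => M.obj ⟨X, x⟩) ⟶ ∐ fun y : P.obj Y => M.obj ⟨Y, y⟩ :=
  Limits.Sigma.desc fun x =>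
    M.map (⟨f, rfl⟩ : (⟨X, x⟩ : Elt P) ⟶ ⟨Y, P.map f x⟩) ≫ indι M ⟨Y, P.map f x⟩

/-- The equation `P.map f x = y` is kept propositional so that the formula applies to arbitrary
morphisms of `Elt P`. -/
lemma indι_mk_indMap (M : Elt P ⥤ AddCommGrpCat.{u}) {X Y : C} (f : X ⟶ Y) (x : P.obj X)
    (y : P.obj Y) (h : P.map f x = y) :
    indι M ⟨X, x⟩ ≫ indMap M f =
      M.map (⟨f, h⟩ : (⟨X, x⟩ : Elt P) ⟶ ⟨Y, y⟩) ≫ indι M ⟨Y, y⟩ := by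
  subst h
  exact Limits.Sigma.ι_desc _ _

lemma indι_indMap (M : Elt P ⥤ AddCommGrpCat.{u}) {p q : Elt P} (g : p ⟶ q) :
    indι M p ≫ indMap M g.1 = M.map g ≫ indι M q :=
  indι_mk_indMap M g.1 p.pt q.pt g.2

lemma ind_hom_ext {M : Elt P ⥤ AddCommGrpCat.{u}} {X : C} {A : AddCommGrpCat.{u}}
    {f g : (∐ fun x : P.obj X => M.obj ⟨X, x⟩) ⟶ A}
    (h : ∀ x : P.obj X, indι M ⟨X, x⟩ ≫ f = indι M ⟨X, x⟩ ≫ g) : f = g :=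
  Limits.Sigma.hom_ext _ _ h

lemma indι_map {M N : Elt P ⥤ AddCommGrpCat.{u}} (α : M ⟶ N) (p : Elt P) :
    (indι M p ≫ Limits.Sigma.map fun x : P.obj p.base => α.app ⟨p.base, x⟩) =
      α.app p ≫ indι N p :=
  Limits.Sigma.ι_map _ _

lemma indι_desc {M : Elt P ⥤ AddCommGrpCat.{u}} {A : AddCommGrpCat.{u}} (X : C)
    (φ : ∀ x : P.obj X, M.obj ⟨X, x⟩ ⟶ A) (x : P.obj X) :
    indι M ⟨X, x⟩ ≫ Limits.Sigma.desc φ = φ x :=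
  Limits.Sigma.ι_desc _ _

variable (P) in
/-- The module on `C` induced from a module on the category of elements of `P`: its value at `X`
is the direct sum of the values at the elements of `P X`. -/
noncomputable def ind : (Elt P ⥤ AddCommGrpCat.{u}) ⥤ (C ⥤ AddCommGrpCat.{u}) where
  obj M :=
    { obj := fun X => ∐ fun x : P.obj X => M.obj ⟨X, x⟩
      map := fun f => indMap M f
      map_id := fun X => ind_hom_ext fun x => by
        rw [Category.comp_id]
        refine (indι_indMap M (𝟙 (⟨X, x⟩ : Elt P))).trans ?_
        rw [M.map_id, Category.id_comp]
      map_comp := fun {X Y Z} f g => ind_hom_ext fun x => by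
        let f' : (⟨X, x⟩ : Elt P) ⟶ ⟨Y, P.map f x⟩ := ⟨f, rfl⟩
        let g' : (⟨Y, P.map f x⟩ : Elt P) ⟶ ⟨Z, P.map g (P.map f x)⟩ := ⟨g, rfl⟩
        refine (indι_indMap M (f' ≫ g')).trans ?_
        rw [M.map_comp, Category.assoc, ← indι_indMap M g', ← Category.assoc,
          ← indι_indMap M f', Category.assoc] }
  map {M N} α :=
    { app := fun X => Limits.Sigma.map fun x => α.app ⟨X, x⟩
      naturality := fun X Y f => ind_hom_ext fun x => by
        let f' : (⟨X, x⟩ : Elt P) ⟶ ⟨Y, P.map f x⟩ := ⟨f, rfl⟩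
        have h1 := indι_indMap M f'
        have h2 := indι_indMap N f'
        have h3 := indι_map α ⟨X, x⟩
        have h4 := indι_map α ⟨Y, P.map f x⟩
        rw [reassoc_of% h1, h4, reassoc_of% h3, h2, NatTrans.naturality_assoc] }
  map_id M := by
    ext X : 2
    exact ind_hom_ext fun x => (indι_map (𝟙 M) ⟨X, x⟩).trans
      ((Category.id_comp _).trans (Category.comp_id _).symm)
  map_comp {M N Q} α β := by
    ext X : 2
    refine ind_hom_ext fun x => (indι_map (α ≫ β) ⟨X, x⟩).trans ?_
    have h3 := indι_map α ⟨X, x⟩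
    have h4 := indι_map β ⟨X, x⟩
    exact (by rw [reassoc_of% h3, h4, NatTrans.comp_app, Category.assoc] :
      (α ≫ β).app ⟨X, x⟩ ≫ indι Q ⟨X, x⟩ = indι M ⟨X, x⟩ ≫
      (Limits.Sigma.map fun x => α.app ⟨X, x⟩) ≫ Limits.Sigma.map fun x => β.app ⟨X, x⟩)

/-- The morphism out of the induced module given by a morphism into the restriction. -/
noncomputable def indDesc {M : Elt P ⥤ AddCommGrpCat.{u}} {N : C ⥤ AddCommGrpCat.{u}}
    (g : M ⟶ eltProj P ⋙ N) : (ind P).obj M ⟶ N where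
  app X := Limits.Sigma.desc fun x => g.app ⟨X, x⟩
  naturality X Y f := ind_hom_ext fun x => by
    let f' : (⟨X, x⟩ : Elt P) ⟶ ⟨Y, P.map f x⟩ := ⟨f, rfl⟩
    have h1 := indι_indMap M f'
    refine ((reassoc_of% h1) _).trans ?_
    refine (congrArg (M.map f' ≫ ·) (indι_desc (M := M) Y _ (P.map f x))).trans ?_
    refine (g.naturality f').trans ?_
    exact (congrArg (· ≫ N.map f) (indι_desc (M := M) X (fun x => g.app ⟨X, x⟩) x)).symm.trans
      (Category.assoc _ _ _)

lemma indι_indDesc {M : Elt P ⥤ AddCommGrpCat.{u}} {N : C ⥤ AddCommGrpCat.{u}}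
    (g : M ⟶ eltProj P ⋙ N) (p : Elt P) : indι M p ≫ (indDesc g).app p.base = g.app p :=
  indι_desc _ _ _

lemma indDesc_comp {M M' : Elt P ⥤ AddCommGrpCat.{u}} {N : C ⥤ AddCommGrpCat.{u}}
    (f : M ⟶ M') (g : M' ⟶ eltProj P ⋙ N) : indDesc (f ≫ g) = (ind P).map f ≫ indDesc g := by
  ext X : 2
  refine ind_hom_ext fun x => (indι_indDesc (f ≫ g) ⟨X, x⟩).trans ?_
  have h3 : indι M ⟨X, x⟩ ≫ ((ind P).map f).app X = f.app ⟨X, x⟩ ≫ indι M' ⟨X, x⟩ :=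
    indι_map f ⟨X, x⟩
  refine Eq.trans ?_ ((reassoc_of% h3) ((indDesc g).app X)).symm
  exact congrArg (f.app ⟨X, x⟩ ≫ ·) (indι_indDesc g ⟨X, x⟩).symm

variable (P) in
/-- Induction is left adjoint to restriction along the projection. -/
noncomputable def indAdj : ind P ⊣ (Functor.whiskeringLeft _ _ AddCommGrpCat.{u}).obj (eltProj P) :=
  Adjunction.mkOfHomEquiv
    { homEquiv := fun M N =>
        { toFun := fun f =>
            { app := fun p => indι M p ≫ f.app p.base
              naturality := fun p q g => by
                have h1 := indι_indMap M g
                have h2 := f.naturality g.1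
                refine ((reassoc_of% h1) (f.app q.base)).symm.trans ?_
                exact (congrArg (indι M p ≫ ·) h2).trans (Category.assoc _ _ _).symm }
          invFun := fun g => indDesc g
          left_inv := fun f => by
            ext X : 2
            exact ind_hom_ext fun x => indι_desc _ _ _
          right_inv := fun g => by
            ext p : 2
            exact indι_desc _ _ _ }
      homEquiv_naturality_left_symm := fun f g => indDesc_comp f g
      homEquiv_naturality_right := fun f g => by
        ext p : 2
        exact (Category.assoc _ _ _).symm }

instance : (ind P).PreservesZeroMorphisms where
  map_zero M N := by
    ext X : 2
    exact ind_hom_ext fun x => (indι_map (0 : M ⟶ N) ⟨X, x⟩).trans (zero_comp.trans comp_zero.symm)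

/-- Induction is a direct sum at each object, and direct sums are exact. -/
lemma ind_shortExact {S : ShortComplex (Elt P ⥤ AddCommGrpCat.{u})} (hS : S.ShortExact) :
    (S.map (ind P)).ShortExact :=
  shortExact_of_forall_evaluation _ fun X =>
    shortExact_coproduct (fun x : P.obj X => S.map ((evaluation _ _).obj ⟨X, x⟩))
      fun _ => ShortExact.evaluation hS _

/-- The homomorphism from the integers with a given value at `1`. -/
def intHom {A : AddCommGrpCat.{u}} (a : A) : AddCommGrpCat.of (ULift.{u} ℤ) ⟶ A :=
  AddCommGrpCat.ofHom ((zmultiplesHom A a).comp AddEquiv.ulift.toAddMonoidHom)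

lemma intHom_one {A : AddCommGrpCat.{u}} (a : A) : (intHom a).hom (ULift.up 1) = a :=
  one_zsmul a

lemma int_hom_ext {A : AddCommGrpCat.{u}} {f g : AddCommGrpCat.of (ULift.{u} ℤ) ⟶ A}
    (h : f.hom (ULift.up 1) = g.hom (ULift.up 1)) : f = g := by
  refine AddCommGrpCat.hom_ext (AddMonoidHom.ext fun n => ?_)
  have : n = n.down • (ULift.up 1 : ULift.{u} ℤ) := by
    ext
    simp
  rw [this, map_zsmul, map_zsmul, h]

variable (P) in
/-- The constant module `ℤ` on the category of elements. -/
abbrev constInt : Elt P ⥤ AddCommGrpCat.{u} :=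
  (Functor.const _).obj (AddCommGrpCat.of (ULift.{u} ℤ))

/-- The canonical map from the module induced from the constant module to the free module. -/
noncomputable def indConstHom : (ind P).obj (constInt P) ⟶ lin P where
  app X := Limits.Sigma.desc fun x => intHom (A := (lin P).obj X) (FreeAbelianGroup.of x)
  naturality X Y f := ind_hom_ext fun x => by
    let f' : (⟨X, x⟩ : Elt P) ⟶ ⟨Y, P.map f x⟩ := ⟨f, rfl⟩
    have h1 := indι_indMap (constInt P) f'
    refine ((reassoc_of% h1) _).trans ?_
    refine Eq.trans ?_ ((congrArg (· ≫ (lin P).map f)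
      (indι_desc (M := constInt P) X _ x)).symm.trans (Category.assoc _ _ _))
    refine (congrArg (_ ≫ ·) (indι_desc (M := constInt P) Y _ (P.map f x))).trans ?_
    exact (Category.id_comp _).trans (int_hom_ext ((intHom_one _).trans
      (((congrArg ((lin P).map f).hom (intHom_one _)).trans (lin_map_of P f x)).symm)))

lemma indι_indConstHom (X : C) (x : P.obj X) :
    indι (constInt P) ⟨X, x⟩ ≫ indConstHom.app X =
      intHom (A := (lin P).obj X) (FreeAbelianGroup.of x) :=
  indι_desc _ _ _

lemma indConst_natural {X Y : C} (f : X ⟶ Y) (x : P.obj X) :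
    (indι (constInt P) (⟨Y, P.map f x⟩ : Elt P)).hom (ULift.up 1) =
      ((ind P).obj (constInt P)).map f
        ((indι (constInt P) (⟨X, x⟩ : Elt P)).hom (ULift.up 1)) :=
  congrArg (fun k => k.hom (ULift.up (1 : ℤ)))
    (indι_indMap (constInt P) (⟨f, rfl⟩ : (⟨X, x⟩ : Elt P) ⟶ ⟨Y, P.map f x⟩)).symm

/-- The canonical map from the free module to the module induced from the constant module. -/
noncomputable def indConstInv : lin P ⟶ (ind P).obj (constInt P) :=
  linDesc (fun X x => (indι (constInt P) (⟨X, x⟩ : Elt P)).hom (ULift.up 1)) indConst_natural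

lemma indConstInv_app_of (X : C) (x : P.obj X) :
    (indConstInv.app X).hom (FreeAbelianGroup.of x) =
      (indι (constInt P) (⟨X, x⟩ : Elt P)).hom (ULift.up 1) :=
  linDesc_app_of _ indConst_natural _ _

variable (P) in
/-- The module induced from the constant module `ℤ` is the free module on `P`. -/
noncomputable def indConstIso : (ind P).obj (constInt P) ≅ lin P where
  hom := indConstHom
  inv := indConstInv
  hom_inv_id := by
    ext X : 2
    refine ind_hom_ext fun x => ?_
    refine (Category.assoc _ _ _).symm.trans (Eq.trans ?_ (Category.comp_id _).symm)
    refine (congrArg (· ≫ indConstInv.app X) (indι_indConstHom X x)).trans (int_hom_ext ?_)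
    exact (congrArg (indConstInv.app X).hom (intHom_one _)).trans (indConstInv_app_of X x)
  inv_hom_id := lin_hom_ext fun X x => by
    refine (congrArg (indConstHom.app X).hom (indConstInv_app_of X x)).trans ?_
    exact (congrArg (fun k => k.hom (ULift.up (1 : ℤ))) (indι_indConstHom X x)).trans
      (intHom_one _)

end Induction

/-! ### Maps between coset spaces of `G` and of a subgroup `K`. -/

section Cosets

variable {G : Type u} [Group G]

/-- The `G`-map out of `G ⧸ H` determined by an `H`-fixed element. -/
def homOfFixed (H : Subgroup G) {Y : Type*} [MulAction G Y] (y : Y)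
    (hy : ∀ h ∈ H, h • y = y) : (G ⧸ H) →[G] Y where
  toFun := Quotient.lift (fun g => g • y) (fun a b hab => by
    have := hy _ (QuotientGroup.leftRel_apply.1 hab)
    calc a • y = a • (a⁻¹ * b) • y := by rw [this]
      _ = b • y := by rw [smul_smul, mul_inv_cancel_left])
  map_smul' g x := by
    induction x using QuotientGroup.induction_on with
    | H a => exact mul_smul g a y

lemma homOfFixed_one (H : Subgroup G) {Y : Type*} [MulAction G Y] (y : Y)
    (hy : ∀ h ∈ H, h • y = y) : homOfFixed H y hy ((1 : G) : G ⧸ H) = y := one_smul G y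

lemma coset_hom_mk (H : Subgroup G) {Y : Type*} [MulAction G Y] (f : (G ⧸ H) →[G] Y) (g : G) :
    f (g : G ⧸ H) = g • f ((1 : G) : G ⧸ H) := by
  rw [← map_smul]
  congr 1
  exact congrArg _ (mul_one g).symm

lemma coset_hom_ext (H : Subgroup G) {Y : Type*} [MulAction G Y] {f f' : (G ⧸ H) →[G] Y}
    (h : f ((1 : G) : G ⧸ H) = f' ((1 : G) : G ⧸ H)) : f = f' := by
  ext x
  induction x using QuotientGroup.induction_on with
  | H a => rw [coset_hom_mk H f, coset_hom_mk H f', h]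

lemma coset_hom_fixed (H : Subgroup G) {Y : Type*} [MulAction G Y] (f : (G ⧸ H) →[G] Y) {h : G}
    (hh : h ∈ H) : h • f ((1 : G) : G ⧸ H) = f ((1 : G) : G ⧸ H) := by
  rw [← coset_hom_mk]
  congr 1
  exact (QuotientGroup.eq.2 (by simpa using hh)).symm

lemma smul_mk_eq_iff (H : Subgroup G) (h g : G) :
    h • (g : G ⧸ H) = (g : G ⧸ H) ↔ g⁻¹ * h * g ∈ H := by
  rw [eq_comm, mul_assoc]
  exact QuotientGroup.eq

variable {K : Subgroup G}

/-- The inclusion of `K ⧸ L` into `G ⧸ L`. -/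
def cosetIncl (L : Subgroup K) : K ⧸ L → G ⧸ L.map K.subtype :=
  Quotient.map' (fun k => (k : G)) fun a b hab => by
    rw [QuotientGroup.leftRel_apply] at hab ⊢
    exact ⟨a⁻¹ * b, hab, rfl⟩

lemma cosetIncl_mk (L : Subgroup K) (k : K) :
    cosetIncl L (k : K ⧸ L) = ((k : G) : G ⧸ L.map K.subtype) := rfl

lemma cosetIncl_smul (L : Subgroup K) (k : K) (x : K ⧸ L) :
    cosetIncl L (k • x) = (k : G) • cosetIncl L x := by
  induction x using QuotientGroup.induction_on with
  | H a => rfl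

lemma cosetIncl_injective (L : Subgroup K) : Function.Injective (cosetIncl L) := by
  intro x y h
  induction x using QuotientGroup.induction_on with
  | H a =>
    induction y using QuotientGroup.induction_on with
    | H b =>
      rw [cosetIncl_mk, cosetIncl_mk, QuotientGroup.eq] at h
      rw [QuotientGroup.eq]
      obtain ⟨c, hc, hcab⟩ := h
      have : c = a⁻¹ * b := Subtype.ext hcab
      exact this ▸ hc

/-- The `G`-map induced from a `K`-map. -/
def cosetInd {L L' : Subgroup K} (f : (K ⧸ L) →[K] (K ⧸ L')) :
    (G ⧸ L.map K.subtype) →[G] (G ⧸ L'.map K.subtype) :=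
  homOfFixed _ (cosetIncl L' (f ((1 : K) : K ⧸ L))) (by
    rintro _ ⟨l, hl, rfl⟩
    rw [Subgroup.subtype_apply, ← cosetIncl_smul, coset_hom_fixed _ _ hl])

lemma cosetInd_cosetIncl {L L' : Subgroup K} (f : (K ⧸ L) →[K] (K ⧸ L')) (x : K ⧸ L) :
    cosetInd f (cosetIncl L x) = cosetIncl L' (f x) := by
  induction x using QuotientGroup.induction_on with
  | H a =>
    rw [coset_hom_mk L f, cosetIncl_smul]
    rfl

lemma coset_hom_ext' {L : Subgroup K} {Y : Type*} [MulAction G Y]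
    {f f' : (G ⧸ L.map K.subtype) →[G] Y} (h : ∀ x, f (cosetIncl L x) = f' (cosetIncl L x)) :
    f = f' :=
  coset_hom_ext _ (h (1 : K))

/-- The projection `G ⧸ L → G ⧸ K`. -/
def cosetProj (L : Subgroup K) : (G ⧸ L.map K.subtype) →[G] (G ⧸ K) :=
  homOfFixed _ ((1 : G) : G ⧸ K) (by
    rintro _ ⟨l, -, rfl⟩
    rw [smul_mk_eq_iff]
    simp)

lemma cosetProj_mk (L : Subgroup K) (g : G) :
    cosetProj L (g : G ⧸ L.map K.subtype) = (g : G ⧸ K) :=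
  congrArg (QuotientGroup.mk (s := K)) (mul_one g)

lemma cosetProj_cosetIncl (L : Subgroup K) (x : K ⧸ L) :
    cosetProj L (cosetIncl L x) = ((1 : G) : G ⧸ K) := by
  induction x using QuotientGroup.induction_on with
  | H a =>
    rw [cosetIncl_mk, cosetProj_mk, QuotientGroup.eq]
    simp

end Cosets

/-! ### The orbit category of `K` as orbits over `G/K`, and induction from `K` to `G`. -/

section OrbitInduction

variable {G : Type u} [Group G] {F : Set (Subgroup G)}

lemma map_mem_of_mem_familyInter (hF : IsFullFamily F) {K : Subgroup G} {L : Subgroup K}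
    (hL : L ∈ familyInter F K) : L.map K.subtype ∈ F := by
  obtain ⟨H, hH, rfl⟩ := hL
  exact hF.subgroup_mem H hH _ (by
    rintro _ ⟨x, hx, rfl⟩
    exact hx)

/-- The functor between orbit categories sending `K ⧸ L` to `G ⧸ L`. -/
def orbitIncl (hF : IsFullFamily F) (K : Subgroup G) :
    OrbitCat (familyInter F K) ⥤ OrbitCat F where
  obj X := ⟨X.subgroup.map K.subtype, map_mem_of_mem_familyInter hF X.mem⟩
  map f := cosetInd f
  map_id _ := coset_hom_ext' fun x => cosetInd_cosetIncl (MulActionHom.id K) x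
  map_comp f g := coset_hom_ext' fun x =>
    (cosetInd_cosetIncl (MulActionHom.comp g f) x).trans
      ((congrArg (cosetInd g) (cosetInd_cosetIncl f x)).trans (cosetInd_cosetIncl g _)).symm

variable (F) in
/-- The `G`-maps from orbits into `G ⧸ K`. -/
def cosetMaps (K : Subgroup G) : (OrbitCat F)ᵒᵖ ⥤ Type u where
  obj X := (G ⧸ X.unop.subgroup) →[G] (G ⧸ K)
  map f := TypeCat.ofHom fun x => MulActionHom.comp x f.unop
  map_id _ := rfl
  map_comp _ _ := rfl

/-- The orbit category of `K` as the category of orbits of `G` over `G ⧸ K`. -/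
def orbitOver (hF : IsFullFamily F) (K : Subgroup G) :
    (OrbitCat (familyInter F K))ᵒᵖ ⥤ Elt (cosetMaps F K) where
  obj X := ⟨op ((orbitIncl hF K).obj X.unop), cosetProj X.unop.subgroup⟩
  map {X _} f := ⟨((orbitIncl hF K).map f.unop).op, coset_hom_ext' fun x =>
    ((congrArg (cosetProj X.unop.subgroup) (cosetInd_cosetIncl f.unop x)).trans
      (cosetProj_cosetIncl _ _)).trans (cosetProj_cosetIncl _ _).symm⟩
  map_id X := Subtype.ext (congrArg Quiver.Hom.op ((orbitIncl hF K).map_id X.unop))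
  map_comp f g :=
    Subtype.ext (congrArg Quiver.Hom.op ((orbitIncl hF K).map_comp g.unop f.unop))

instance (hF : IsFullFamily F) (K : Subgroup G) : (orbitOver hF K).Faithful where
  map_injective {X Y f g} h := by
    have h1 : cosetInd f.unop = cosetInd g.unop :=
      congrArg Quiver.Hom.unop (congrArg Subtype.val h)
    refine Quiver.Hom.unop_inj ?_
    refine coset_hom_ext _ (cosetIncl_injective _ ?_)
    have h2 := DFunLike.congr_fun h1 (cosetIncl Y.unop.subgroup ((1 : K) : K ⧸ Y.unop.subgroup))
    rw [cosetInd_cosetIncl, cosetInd_cosetIncl] at h2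
    exact h2

/-- Lying over `G/K` forces the representative `g` of the image of the base coset into `K`. Its
class in `K/L'` is fixed by `L`, because `K/L'` embeds into `G/L'`. -/
lemma exists_cosetInd_eq {K : Subgroup G} {L L' : Subgroup K}
    (φ : (G ⧸ L.map K.subtype) →[G] (G ⧸ L'.map K.subtype))
    (hφ : (cosetProj L').comp φ = cosetProj L) : ∃ f, cosetInd f = φ := by
  obtain ⟨g, hg⟩ := QuotientGroup.mk_surjective (φ ((1 : G) : G ⧸ L.map K.subtype))
  have h1 := DFunLike.congr_fun hφ ((1 : G) : G ⧸ L.map K.subtype)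
  have h2 : cosetProj L' (φ ((1 : G) : G ⧸ L.map K.subtype)) =
    cosetProj L ((1 : G) : G ⧸ L.map K.subtype) := h1
  rw [← hg, cosetProj_mk, cosetProj_mk, eq_comm, QuotientGroup.eq] at h2
  have hgK : g ∈ K := by simpa using h2
  have hfix : ∀ l ∈ L, l • ((⟨g, hgK⟩ : K) : K ⧸ L') = ((⟨g, hgK⟩ : K) : K ⧸ L') := by
    intro l hl
    apply cosetIncl_injective
    rw [cosetIncl_smul]
    change (l : G) • (g : G ⧸ L'.map K.subtype) = (g : G ⧸ L'.map K.subtype)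
    rw [hg]
    exact coset_hom_fixed _ φ ⟨l, hl, rfl⟩
  refine ⟨homOfFixed L _ hfix, coset_hom_ext _ ?_⟩
  rw [← hg]
  refine (cosetInd_cosetIncl (homOfFixed L _ hfix) ((1 : K) : K ⧸ L)).trans ?_
  rw [homOfFixed_one, cosetIncl_mk]

instance (hF : IsFullFamily F) (K : Subgroup G) : (orbitOver hF K).Full where
  map_surjective {X Y} φ := by
    obtain ⟨φ, hφ⟩ := φ
    obtain ⟨f, hf⟩ := exists_cosetInd_eq φ.unop hφ
    exact ⟨Quiver.Hom.op f, Subtype.ext (congrArg Quiver.Hom.op hf)⟩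

/-- If `x` sends the base coset to `gK`, then `g⁻¹ X g ≤ K` for the stabiliser `X`. This conjugate
is again in `F`, and right multiplication by `g` gives the isomorphism over `G/K`. -/
lemma exists_orbitIncl_iso (hF : IsFullFamily F) (K : Subgroup G) (X : OrbitCat F)
    (x : (G ⧸ X.subgroup) →[G] (G ⧸ K)) :
    ∃ (Y : OrbitCat (familyInter F K)) (e : X ≅ (orbitIncl hF K).obj Y),
      (cosetProj Y.subgroup).comp e.hom = x := by
  obtain ⟨g, hg⟩ := QuotientGroup.mk_surjective (x ((1 : G) : G ⧸ X.subgroup))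
  let H := X.subgroup.map (MulAut.conj g⁻¹).toMonoidHom
  have hH : H ∈ F := hF.conj_mem _ X.mem _
  have hHK : H ≤ K := by
    rintro _ ⟨h, hh, rfl⟩
    have h1 := coset_hom_fixed _ x hh
    rw [← hg, smul_mk_eq_iff] at h1
    simpa using h1
  let L : Subgroup K := H.subgroupOf K
  have hL : L.map K.subtype = H := by
    rw [Subgroup.subgroupOf_map_subtype, inf_eq_left.2 hHK]
  have hα : ∀ h ∈ X.subgroup, h • (g : G ⧸ L.map K.subtype) = (g : G ⧸ L.map K.subtype) := by
    intro h hh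
    rw [smul_mk_eq_iff, hL]
    exact ⟨h, hh, by simp⟩
  have hβ : ∀ l ∈ L.map K.subtype, l • ((g⁻¹ : G) : G ⧸ X.subgroup) = (g⁻¹ : G) := by
    intro l hl
    rw [hL] at hl
    obtain ⟨h, hh, rfl⟩ := hl
    rw [smul_mk_eq_iff]
    simpa [mul_assoc] using hh
  let Y : OrbitCat (familyInter F K) := ⟨L, H, hH, rfl⟩
  let α : X ⟶ (orbitIncl hF K).obj Y := homOfFixed X.subgroup _ hα
  let β : (orbitIncl hF K).obj Y ⟶ X := homOfFixed (L.map K.subtype) _ hβ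
  have hαβ : (homOfFixed (L.map K.subtype) _ hβ).comp (homOfFixed X.subgroup _ hα) =
      MulActionHom.id G := by
    refine coset_hom_ext X.subgroup
      ((congrArg (homOfFixed _ _ hβ) (homOfFixed_one X.subgroup _ hα)).trans ?_)
    exact congrArg QuotientGroup.mk (mul_inv_cancel g)
  have hβα : (homOfFixed X.subgroup _ hα).comp (homOfFixed (L.map K.subtype) _ hβ) =
      MulActionHom.id G := by
    refine coset_hom_ext (L.map K.subtype)
      ((congrArg (homOfFixed _ _ hα) (homOfFixed_one _ _ hβ)).trans ?_)
    exact congrArg QuotientGroup.mk (inv_mul_cancel g)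
  refine ⟨Y, ⟨α, β, hαβ, hβα⟩, ?_⟩
  exact coset_hom_ext X.subgroup ((congrArg (cosetProj L) (homOfFixed_one X.subgroup _ hα)).trans
    ((cosetProj_mk L g).trans hg))

instance (hF : IsFullFamily F) (K : Subgroup G) : (orbitOver hF K).EssSurj where
  mem_essImage p := by
    obtain ⟨X, x⟩ := p
    obtain ⟨Y, e, he⟩ := exists_orbitIncl_iso hF K X.unop x
    have he' : x.comp e.inv = cosetProj Y.subgroup := by
      rw [← he]
      exact MulActionHom.ext fun y => congrArg (cosetProj Y.subgroup)
        (DFunLike.congr_fun (F := (G ⧸ Y.subgroup.map K.subtype) →[G] (G ⧸ Y.subgroup.map K.subtype))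
          e.inv_hom_id y)
    refine ⟨op Y, ⟨⟨⟨e.hom.op, he⟩, ⟨e.inv.op, he'⟩, ?_, ?_⟩⟩⟩
    · exact Subtype.ext (congrArg Quiver.Hom.op e.inv_hom_id)
    · exact Subtype.ext (congrArg Quiver.Hom.op e.hom_inv_id)

instance (hF : IsFullFamily F) (K : Subgroup G) : (orbitOver hF K).IsEquivalence where

/-- Induction of Bredon modules from the subgroup `K`. -/
noncomputable def orbitInd (hF : IsFullFamily F) (K : Subgroup G) :
    RightModule (familyInter F K) ⥤ RightModule F :=
  (Functor.whiskeringLeft _ _ AddCommGrpCat.{u}).obj (orbitOver hF K).inv ⋙ ind (cosetMaps F K)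

/-- Induction is left adjoint to restriction. -/
noncomputable def orbitIndAdj (hF : IsFullFamily F) (K : Subgroup G) :
    orbitInd hF K ⊣ (Functor.whiskeringLeft _ _ AddCommGrpCat.{u}).obj (orbitIncl hF K).op :=
  ((orbitOver hF K).asEquivalence.toAdjunction.whiskerLeft AddCommGrpCat.{u}).comp
    (indAdj (cosetMaps F K))

instance (hF : IsFullFamily F) (K : Subgroup G) : (orbitInd hF K).PreservesZeroMorphisms where
  map_zero M N := by
    exact (ind (cosetMaps F K)).map_zero _ _

lemma orbitInd_shortExact (hF : IsFullFamily F) (K : Subgroup G)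
    {S : ShortComplex (RightModule (familyInter F K))} (hS : S.ShortExact) :
    (S.map (orbitInd hF K)).ShortExact :=
  ind_shortExact (shortExact_of_forall_evaluation
    (S.map ((Functor.whiskeringLeft _ _ AddCommGrpCat.{u}).obj (orbitOver hF K).inv))
    fun X => ShortExact.evaluation hS ((orbitOver hF K).inv.obj X))

/-- The module induced from the trivial module is the permutation module of `G ⧸ K`. -/
noncomputable def orbitIndTrivialIso (hF : IsFullFamily F) (K : Subgroup G) :
    (orbitInd hF K).obj (trivialModule (familyInter F K)) ≅ lin (cosetMaps F K) :=
  indConstIso (cosetMaps F K)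

end OrbitInduction

/-! ### The constant module as a colimit of permutation modules. -/

section DirectedSets

open Limits

variable {C : Type u} [SmallCategory C]

/-- The augmentation of a permutation module. -/
def aug (Q : C ⥤ Type u) :
    lin Q ⟶ (Functor.const C).obj (AddCommGrpCat.of (ULift.{u} ℤ)) :=
  linDesc (fun _ _ => ULift.up (1 : ℤ)) fun _ _ => rfl

lemma aug_app_of (Q : C ⥤ Type u) {X : C} (x : Q.obj X) :
    ((aug Q).app X).hom (FreeAbelianGroup.of x) = ULift.up (1 : ℤ) :=
  FreeAbelianGroup.lift_apply_of _ _

/-- The functor `lin`. -/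
def linFunctor : (C ⥤ Type u) ⥤ (C ⥤ AddCommGrpCat.{u}) :=
  (Functor.whiskeringRight _ _ _).obj AddCommGrpCat.free

/-- The morphism of permutation modules induced by a natural map. -/
def linMap {Q Q' : C ⥤ Type u} (f : Q ⟶ Q') : lin Q ⟶ lin Q' :=
  linFunctor.map f

lemma linMap_app_of {Q Q' : C ⥤ Type u} (f : Q ⟶ Q') {X : C} (x : Q.obj X) :
    ((linMap f).app X).hom (FreeAbelianGroup.of x) = FreeAbelianGroup.of (f.app X x) :=
  FreeAbelianGroup.map_of_apply _

/-- All elements of the values of the diagram are identified further on. -/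
structure IsEventuallyTrivial {J : Type*} [Category J] (D : J ⥤ C ⥤ Type u) : Prop where
  exists_elt : ∀ X, ∃ j, Nonempty ((D.obj j).obj X)
  exists_eq : ∀ (X : C) {i j : J} (x : (D.obj i).obj X) (y : (D.obj j).obj X),
    ∃ (k : J) (f : i ⟶ k) (g : j ⟶ k), (D.map f).app X x = (D.map g).app X y

/-- The cocone given by the augmentations. -/
def augCocone {J : Type*} [Category J] (D : J ⥤ C ⥤ Type u) : Cocone (D ⋙ linFunctor) where
  pt := (Functor.const C).obj (AddCommGrpCat.of (ULift.{u} ℤ))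
  ι :=
    { app := fun j => aug (D.obj j)
      naturality := fun _ j f => lin_hom_ext fun X x =>
        (congrArg ((aug (D.obj j)).app X).hom (linMap_app_of (D.map f) x)).trans
          ((aug_app_of _ _).trans (aug_app_of _ _).symm) }

/-- Generators are identified further along the diagram, so a cocone takes a single value on all of
them; that value defines the map out of `ℤ`. -/
lemma cocone_app_eq {J : Type*} [Category J] {D : J ⥤ C ⥤ Type u} (hD : IsEventuallyTrivial D)
    (s : Cocone (D ⋙ linFunctor)) (X : C) {i j : J} (x : (D.obj i).obj X) (y : (D.obj j).obj X) :
    ((s.ι.app i).app X).hom (FreeAbelianGroup.of x) =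
      ((s.ι.app j).app X).hom (FreeAbelianGroup.of y) := by
  obtain ⟨k, f, g, h⟩ := hD.exists_eq X x y
  have key : ∀ {i : J} (f : i ⟶ k) (x : (D.obj i).obj X),
      ((s.ι.app i).app X).hom (FreeAbelianGroup.of x) =
        ((s.ι.app k).app X).hom (FreeAbelianGroup.of ((D.map f).app X x)) := fun {i} f x => by
    rw [← linMap_app_of, ← s.w f]
    rfl
  rw [key f x, key g y, h]

/-- The constant module `ℤ` is the colimit of the permutation modules. -/
noncomputable def augIsColimit {J : Type*} [Category J] {D : J ⥤ C ⥤ Type u}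
    (hD : IsEventuallyTrivial D) : IsColimit (augCocone D) where
  desc s :=
    { app := fun X => intHom (((s.ι.app (hD.exists_elt X).choose).app X).hom
        (FreeAbelianGroup.of (hD.exists_elt X).choose_spec.some))
      naturality := fun X Y f => by
        refine int_hom_ext ((intHom_one _).trans ?_)
        refine Eq.trans ?_ (congrArg (s.pt.map f).hom (intHom_one _)).symm
        refine Eq.trans ?_ (NatTrans.naturality_apply (s.ι.app _) f _)
        have h1 := cocone_app_eq hD s Y (hD.exists_elt Y).choose_spec.some
          ((D.obj (hD.exists_elt X).choose).map f (hD.exists_elt X).choose_spec.some)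
        have h2 := congrArg ((s.ι.app (hD.exists_elt X).choose).app Y).hom
          (lin_map_of (D.obj (hD.exists_elt X).choose) f (hD.exists_elt X).choose_spec.some)
        exact h1.trans h2.symm }
  fac s j := lin_hom_ext fun X x => by
    refine (congrArg (intHom _).hom (aug_app_of _ x)).trans ((intHom_one _).trans ?_)
    exact cocone_app_eq hD s X _ _
  uniq s m hm := by
    ext X : 2
    refine int_hom_ext (Eq.trans ?_ (intHom_one _).symm)
    rw [← hm]
    exact congrArg (m.app X).hom (aug_app_of _ _).symm

end DirectedSets

/-! ### Resolutions of `ℤ[G/K]` and the diagram of the `G/K`. -/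

section Transport

variable {G : Type u} [Group G] {F : Set (Subgroup G)}

lemma Res.isFlat_cosetMaps (hF : IsFullFamily F) (K : Subgroup G) {n : ℕ}
    (h : Res IsFlat n (trivialModule (familyInter F K))) :
    Res IsFlat n (lin (cosetMaps F K)) :=
  Res.of_iso (fun _ _ => isFlat_of_iso) (orbitIndTrivialIso hF K)
    (Res.map (orbitInd hF K) (fun _ => orbitInd_shortExact hF K)
      (fun M hM => (isFlat_iff_liftFlat _).2
        (((isFlat_iff_liftFlat M).1 hM).map (orbitIncl hF K) (orbitIndAdj hF K))) h)

/-- Needed so that induction, the left adjoint of restriction, preserves projectives. -/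
instance whiskeringLeft_preservesEpimorphisms {C D : Type*} [Category C] [Category D]
    (I : C ⥤ D) :
    ((Functor.whiskeringLeft _ _ AddCommGrpCat.{u}).obj I).PreservesEpimorphisms where
  preserves f hf := by
    rw [NatTrans.epi_iff_epi_app] at hf ⊢
    exact fun X => hf (I.obj X)

lemma Res.projective_cosetMaps (hF : IsFullFamily F) (K : Subgroup G) {n : ℕ}
    (h : Res (fun M => Projective M) n (trivialModule (familyInter F K))) :
    Res (fun M => Projective M) n (lin (cosetMaps F K)) :=
  Res.of_iso (fun _ _ => Projective.of_iso) (orbitIndTrivialIso hF K)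
    (Res.map (orbitInd hF K) (fun _ => orbitInd_shortExact hF K)
      (fun M hM => (orbitIndAdj hF K).map_projective M hM) h)

/-- The projection `G ⧸ K → G ⧸ K'` for `K ≤ K'`. -/
def cosetLE {K K' : Subgroup G} (h : K ≤ K') : (G ⧸ K) →[G] (G ⧸ K') :=
  homOfFixed K ((1 : G) : G ⧸ K') fun k hk => by
    rw [smul_mk_eq_iff]
    simpa using h hk

lemma cosetLE_mk {K K' : Subgroup G} (h : K ≤ K') (g : G) :
    cosetLE h (g : G ⧸ K) = (g : G ⧸ K') :=
  congrArg (QuotientGroup.mk (s := K')) (mul_one g)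

lemma cosetLE_refl (K : Subgroup G) (x : G ⧸ K) : cosetLE le_rfl x = x := by
  induction x using QuotientGroup.induction_on with
  | H g => exact cosetLE_mk le_rfl g

lemma cosetLE_trans {K K' K'' : Subgroup G} (h : K ≤ K') (h' : K' ≤ K'') (x : G ⧸ K) :
    cosetLE (h.trans h') x = cosetLE h' (cosetLE h x) := by
  induction x using QuotientGroup.induction_on with
  | H g => rw [cosetLE_mk, cosetLE_mk, cosetLE_mk]

variable (F) in
/-- The functor sending `K` to the `G`-maps from orbits into `G ⧸ K`. -/
def cosetDiagram : Subgroup G ⥤ (OrbitCat F)ᵒᵖ ⥤ Type u where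
  obj K := cosetMaps F K
  map {K K'} f :=
    { app := fun X => TypeCat.ofHom fun x => MulActionHom.comp (cosetLE (leOfHom f)) x
      naturality := fun _ _ _ => rfl }
  map_id K := by
    ext X x
    change (G ⧸ X.unop.subgroup) →[G] (G ⧸ K) at x
    exact MulActionHom.ext fun y => cosetLE_refl K (x y)
  map_comp {K K' K''} f f' := by
    ext X x
    change (G ⧸ X.unop.subgroup) →[G] (G ⧸ K) at x
    exact MulActionHom.ext fun y => cosetLE_trans (leOfHom f) (leOfHom f') (x y)

lemma isEventuallyTrivial_cosetDiagram {J : Type*} [Category J] (T : J ⥤ Subgroup G)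
    (hF : ∀ H ∈ F, ∃ j, H ≤ T.obj j) (hdir : ∀ i j : J, ∃ k, Nonempty (i ⟶ k) ∧ Nonempty (j ⟶ k))
    (hG : ∀ g, ∃ j, g ∈ T.obj j) : IsEventuallyTrivial (T ⋙ cosetDiagram F) where
  exists_elt X := by
    obtain ⟨j, hj⟩ := hF X.unop.subgroup X.unop.mem
    exact ⟨j, ⟨cosetLE hj⟩⟩
  exists_eq X i j x y := by
    change (G ⧸ X.unop.subgroup) →[G] (G ⧸ T.obj i) at x
    change (G ⧸ X.unop.subgroup) →[G] (G ⧸ T.obj j) at y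
    obtain ⟨a, ha⟩ := QuotientGroup.mk_surjective (x ((1 : G) : G ⧸ X.unop.subgroup))
    obtain ⟨b, hb⟩ := QuotientGroup.mk_surjective (y ((1 : G) : G ⧸ X.unop.subgroup))
    -- The maps send the base coset to the classes of `a` and `b`; these agree in `G/K` as soon as
    -- `K` contains `a⁻¹ * b`.
    obtain ⟨l, hl⟩ := hG (a⁻¹ * b)
    obtain ⟨m, ⟨f⟩, ⟨g⟩⟩ := hdir i j
    obtain ⟨k, ⟨f'⟩, ⟨g'⟩⟩ := hdir m l
    refine ⟨k, f ≫ f', g ≫ f', coset_hom_ext X.unop.subgroup ?_⟩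
    change cosetLE (leOfHom (T.map (f ≫ f'))) (x ((1 : G) : G ⧸ X.unop.subgroup)) =
      cosetLE (leOfHom (T.map (g ≫ f'))) (y ((1 : G) : G ⧸ X.unop.subgroup))
    rw [← ha, ← hb, cosetLE_mk, cosetLE_mk, QuotientGroup.eq]
    exact leOfHom (T.map g') hl

end Transport

/-! ### The mapping telescope of a sequence. -/

section Telescope

open Limits

variable {C : Type u} [SmallCategory C] (D : ℕ ⥤ C ⥤ Type u)

/-- The disjoint union of the values at `X` of the terms of a sequence. -/
abbrev TeleSet (X : C) : Type u := Σ i, (D.obj i).obj X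

/-- The map moving every term of a sequence to the next one. -/
def teleStep (X : C) (p : TeleSet D X) : TeleSet D X :=
  ⟨p.1 + 1, (D.map (homOfLE p.1.le_succ)).app X p.2⟩

/-- The disjoint union of the terms of a sequence. -/
def teleSets : C ⥤ Type u where
  obj X := TeleSet D X
  map f := TypeCat.ofHom fun p => ⟨p.1, (D.obj p.1).map f p.2⟩
  map_id X := by ext p <;> simp
  map_comp f g := by ext p <;> simp

lemma teleStep_natural {X Y : C} (f : X ⟶ Y) (p : TeleSet D X) :
    teleStep D Y ((teleSets D).map f p) = (teleSets D).map f (teleStep D X p) := by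
  obtain ⟨i, x⟩ := p
  have h := NatTrans.naturality_apply (D.map (homOfLE i.le_succ)) f x
  exact congrArg (Sigma.mk (i + 1)) h

/-- The natural map moving every term of a sequence to the next one. -/
def teleShift : teleSets D ⟶ teleSets D where
  app X := TypeCat.ofHom (teleStep D X)
  naturality X Y f := by
    ext p
    exact teleStep_natural D f p

/-- The inclusion of the `i`-th term. -/
def teleIncl (i : ℕ) : D.obj i ⟶ teleSets D where
  app _ := TypeCat.ofHom fun x => ⟨i, x⟩
  naturality _ _ _ := rfl

/-- The permutation modules of the terms form a coproduct diagram. -/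
def teleCofan : Cofan fun i : ULift.{u} ℕ => lin (D.obj i.down) :=
  Cofan.mk (lin (teleSets D)) fun i => linMap (teleIncl D i.down)

lemma teleCofan_natural (s : Cofan fun i : ULift.{u} ℕ => lin (D.obj i.down)) {X Y : C}
    (f : X ⟶ Y) (p : (teleSets D).obj X) :
    ((s.inj ⟨((teleSets D).map f p).1⟩).app Y).hom
        (FreeAbelianGroup.of ((teleSets D).map f p).2) =
      s.pt.map f (((s.inj ⟨p.1⟩).app X).hom (FreeAbelianGroup.of p.2)) := by
  refine Eq.trans ?_ (NatTrans.naturality_apply (s.inj ⟨p.1⟩) f (FreeAbelianGroup.of p.2))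
  exact congrArg ((s.inj ⟨p.1⟩).app Y).hom (lin_map_of (D.obj p.1) f p.2).symm

/-- The morphism out of the permutation module of a disjoint union. -/
def teleDesc (s : Cofan fun i : ULift.{u} ℕ => lin (D.obj i.down)) : lin (teleSets D) ⟶ s.pt :=
  linDesc (fun X p => ((s.inj ⟨p.1⟩).app X).hom (FreeAbelianGroup.of p.2))
    (teleCofan_natural D s)

lemma teleDesc_app_of (s : Cofan fun i : ULift.{u} ℕ => lin (D.obj i.down)) (X : C)
    (p : TeleSet D X) : ((teleDesc D s).app X).hom (FreeAbelianGroup.of p) =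
      ((s.inj ⟨p.1⟩).app X).hom (FreeAbelianGroup.of p.2) :=
  FreeAbelianGroup.lift_apply_of _ _

/-- The permutation module of a disjoint union is the coproduct of permutation modules. -/
def teleIsColimit : IsColimit (teleCofan D) :=
  Cofan.IsColimit.mk _ (teleDesc D)
    (fun s i => lin_hom_ext fun X x =>
      (congrArg ((teleDesc D s).app X).hom (linMap_app_of (teleIncl D i.down) x)).trans
        (teleDesc_app_of D s X ⟨i.down, x⟩))
    fun s m hm => lin_hom_ext fun X p => by
      refine Eq.trans ?_ (teleDesc_app_of D s X p).symm
      rw [← hm]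
      exact congrArg (m.app X).hom (linMap_app_of (teleIncl D p.1) p.2).symm

variable {D}

lemma Res.teleSets {n : ℕ} (h : ∀ i, Res (fun M => Projective M) n (lin (D.obj i))) :
    Res (fun M => Projective M) n (lin (teleSets D)) :=
  Res.of_iso (fun _ _ => Projective.of_iso)
    ((coproductIsCoproduct _).coconePointUniqueUpToIso (teleIsColimit D))
    (Res.coproduct (P := fun M => Projective M) (fun M hM => by
      have := hM
      infer_instance) _ fun i : ULift.{u} ℕ => h i.down)

variable (D)

lemma telescope_zero : (𝟙 (lin (teleSets D)) - linMap (teleShift D)) ≫ aug (teleSets D) = 0 := by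
  rw [Preadditive.sub_comp, Category.id_comp, sub_eq_zero]
  refine lin_hom_ext fun X p => ?_
  refine (aug_app_of _ p).trans ?_
  refine (Eq.trans ?_ (congrArg ((aug _).app X).hom (linMap_app_of (teleShift D) p)).symm)
  exact (aug_app_of _ _).symm

/-- The telescope of a sequence. -/
def telescope : ShortComplex (C ⥤ AddCommGrpCat.{u}) :=
  ShortComplex.mk _ _ (telescope_zero D)

/-- The difference of the identity and the map induced by `teleStep`. -/
def shiftHom (X : C) : FreeAbelianGroup (TeleSet D X) →+ FreeAbelianGroup (TeleSet D X) :=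
  AddMonoidHom.id _ - FreeAbelianGroup.map (teleStep D X)

lemma shiftHom_of (X : C) (p : TeleSet D X) : shiftHom D X (FreeAbelianGroup.of p) =
    FreeAbelianGroup.of p - FreeAbelianGroup.of (teleStep D X p) :=
  congrArg (FreeAbelianGroup.of p - ·) (FreeAbelianGroup.map_of_apply p)

/-- The decomposition according to the terms of the sequence. -/
noncomputable def levels (X : C) :
    FreeAbelianGroup (TeleSet D X) →+ (ℕ →₀ FreeAbelianGroup (TeleSet D X)) :=
  FreeAbelianGroup.lift fun p => Finsupp.single p.1 (FreeAbelianGroup.of p)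

lemma levels_of (X : C) (p : TeleSet D X) :
    levels D X (FreeAbelianGroup.of p) = Finsupp.single p.1 (FreeAbelianGroup.of p) :=
  FreeAbelianGroup.lift_apply_of _ _

lemma sum_levels (X : C) (v : FreeAbelianGroup (TeleSet D X)) :
    Finsupp.liftAddHom (fun _ => AddMonoidHom.id _) (levels D X v) = v := by
  have : ((Finsupp.liftAddHom fun _ => AddMonoidHom.id _).comp (levels D X)) =
      AddMonoidHom.id _ := FreeAbelianGroup.lift_ext _ _ fun p => by
    simp [levels_of]
  exact DFunLike.congr_fun this v

lemma levels_map_zero (X : C) (v : FreeAbelianGroup (TeleSet D X)) :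
    levels D X (FreeAbelianGroup.map (teleStep D X) v) 0 = 0 := by
  have : (Finsupp.applyAddHom 0).comp
      ((levels D X).comp (FreeAbelianGroup.map (teleStep D X))) = 0 :=
    FreeAbelianGroup.lift_ext _ _ fun p => by
      change levels D X (FreeAbelianGroup.map (teleStep D X) (FreeAbelianGroup.of p)) 0 = 0
      rw [FreeAbelianGroup.map_of_apply, levels_of]
      exact Finsupp.single_eq_of_ne (Nat.succ_ne_zero p.1).symm
  exact DFunLike.congr_fun this v

lemma levels_map_succ (X : C) (v : FreeAbelianGroup (TeleSet D X)) (n : ℕ) :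
    levels D X (FreeAbelianGroup.map (teleStep D X) v) (n + 1) =
      FreeAbelianGroup.map (teleStep D X) (levels D X v n) := by
  have : (Finsupp.applyAddHom (n + 1)).comp
        ((levels D X).comp (FreeAbelianGroup.map (teleStep D X))) =
      (FreeAbelianGroup.map (teleStep D X)).comp ((Finsupp.applyAddHom n).comp (levels D X)) :=
    FreeAbelianGroup.lift_ext _ _ fun p => by
      change levels D X (FreeAbelianGroup.map (teleStep D X) (FreeAbelianGroup.of p)) (n + 1) =
        FreeAbelianGroup.map (teleStep D X) (levels D X (FreeAbelianGroup.of p) n)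
      rw [FreeAbelianGroup.map_of_apply, levels_of, levels_of]
      by_cases h : n = p.1
      · subst h
        rw [Finsupp.single_eq_same, FreeAbelianGroup.map_of_apply]
        exact Finsupp.single_eq_same
      · rw [Finsupp.single_eq_of_ne h, map_zero]
        exact Finsupp.single_eq_of_ne fun h' => h (Nat.succ_injective h')
  exact DFunLike.congr_fun this v

/-- If `v` equals its own shift, its component at level 0 is zero and each later one is the shift of
the preceding one, so all vanish by induction. -/
lemma shiftHom_injective (X : C) : Function.Injective (shiftHom D X) := by
  rw [injective_iff_map_eq_zero]
  intro v hv
  have hv' : v = FreeAbelianGroup.map (teleStep D X) v := sub_eq_zero.1 hv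
  have h : ∀ n, levels D X v n = 0 := by
    intro n
    induction n with
    | zero =>
      rw [hv']
      exact levels_map_zero D X v
    | succ n ih =>
      rw [hv', levels_map_succ, ih, map_zero]
  rw [← sum_levels D X v, show levels D X v = 0 from Finsupp.ext h, map_zero]

variable {D}

/-- The difference is a telescoping sum of one-step differences, which are values of `shiftHom` on
generators. -/
lemma of_sub_of_mem_range (X : C) {i j : ℕ} (f : i ⟶ j) (x : (D.obj i).obj X) :
    FreeAbelianGroup.of (⟨i, x⟩ : TeleSet D X) -
      FreeAbelianGroup.of (⟨j, (D.map f).app X x⟩ : TeleSet D X) ∈ (shiftHom D X).range := by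
  obtain ⟨k, rfl⟩ := Nat.exists_eq_add_of_le (leOfHom f)
  induction k with
  | zero =>
    rw [show f = 𝟙 _ from rfl, D.map_id]
    exact ⟨0, (map_zero _).trans (sub_self _).symm⟩
  | succ k ih =>
    let f' : i ⟶ i + k := homOfLE (Nat.le_add_right i k)
    have h := AddSubgroup.add_mem _ (ih f')
      ⟨FreeAbelianGroup.of (⟨i + k, (D.map f').app X x⟩ : TeleSet D X), rfl⟩
    rw [shiftHom_of, sub_add_sub_cancel] at h
    have h1 : teleStep D X ⟨i + k, (D.map f').app X x⟩ =
        ⟨i + (k + 1), (D.map f).app X x⟩ := by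
      refine Sigma.ext rfl (heq_of_eq ?_)
      have : f = f' ≫ homOfLE (Nat.le_succ _) := rfl
      rw [this, D.map_comp]
      rfl
    rwa [h1] at h

/-- The sum of the coefficients. -/
def coeffSum (T : Type*) : FreeAbelianGroup T →+ ℤ :=
  FreeAbelianGroup.lift fun _ => 1

lemma coeffSum_of {T : Type*} (t : T) : coeffSum T (FreeAbelianGroup.of t) = 1 :=
  FreeAbelianGroup.lift_apply_of _ _

lemma mem_range_shiftHom (hD : IsEventuallyTrivial D) (X : C) (v : FreeAbelianGroup (TeleSet D X))
    (hv : coeffSum _ v = 0) : v ∈ (shiftHom D X).range := by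
  obtain ⟨i, ⟨x⟩⟩ := hD.exists_elt X
  -- Modulo the range every generator equals the fixed generator at `⟨i, x⟩`, so only the
  -- coefficient sum of `v` remains.
  have key : v - coeffSum _ v • FreeAbelianGroup.of (⟨i, x⟩ : TeleSet D X) ∈
      (shiftHom D X).range := by
    clear hv
    induction v using FreeAbelianGroup.induction_on with
    | zero =>
      rw [map_zero, zero_smul, sub_zero]
      exact AddSubgroup.zero_mem _
    | of p =>
      obtain ⟨j, y⟩ := p
      rw [coeffSum_of, one_zsmul]
      obtain ⟨k, f, g, h⟩ := hD.exists_eq X x y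
      have h1 := AddSubgroup.sub_mem _ (of_sub_of_mem_range X g y) (of_sub_of_mem_range X f x)
      rw [h] at h1
      rwa [sub_sub_sub_cancel_right] at h1
    | neg p h =>
      rw [map_neg, neg_smul, ← neg_sub']
      exact AddSubgroup.neg_mem _ h
    | add a b ha hb =>
      rw [map_add, add_smul, add_sub_add_comm]
      exact AddSubgroup.add_mem _ ha hb
  rwa [hv, zero_smul, sub_zero] at key

lemma aug_app_down (Q : C ⥤ Type u) (X : C) (v : FreeAbelianGroup (Q.obj X)) :
    (((aug Q).app X).hom v : ULift.{u} ℤ).down = coeffSum (Q.obj X) v := by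
  have : (AddEquiv.ulift.toAddMonoidHom).comp (((aug Q).app X).hom) = coeffSum (Q.obj X) :=
    FreeAbelianGroup.lift_ext _ _ fun x =>
      (congrArg ULift.down (aug_app_of Q x)).trans (coeffSum_of x).symm
  exact DFunLike.congr_fun this v

lemma telescope_shortExact (hD : IsEventuallyTrivial D) : (telescope D).ShortExact :=
  shortExact_of_forall_evaluation _ fun X =>
    { exact := (ShortComplex.ab_exact_iff _).2 fun v hv =>
        mem_range_shiftHom hD X v ((aug_app_down (teleSets D) X v).symm.trans
          (congrArg ULift.down hv))
      mono_f := (AddCommGrpCat.mono_iff_injective _).2 (shiftHom_injective D X)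
      epi_g := by
        refine (AddCommGrpCat.epi_iff_surjective _).2 fun n => ?_
        obtain ⟨i, ⟨x⟩⟩ := hD.exists_elt X
        let m : ULift.{u} ℤ := n
        let v : FreeAbelianGroup (TeleSet D X) := FreeAbelianGroup.of ⟨i, x⟩
        have hv : coeffSum (TeleSet D X) (m.down • v) = m.down := by
          rw [map_zsmul, coeffSum_of, smul_eq_mul, mul_one]
        exact ⟨m.down • v, ULift.ext _ _ ((aug_app_down (teleSets D) X (m.down • v)).trans hv)⟩ }

/-- The two direct sums have projective dimension at most `n`, so the cokernel `ℤ` has projective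
dimension at most `n + 1`. -/
lemma res_const_of_telescope (hD : IsEventuallyTrivial D) {n : ℕ}
    (h : ∀ i, Res (fun M => Projective M) n (lin (D.obj i))) :
    Res (fun M => Projective M) (n + 1)
      ((Functor.const C).obj (AddCommGrpCat.of (ULift.{u} ℤ))) := by
  have h1 := (Res.teleSets h).hasProjectiveDimensionLT
  have h2 : HasProjectiveDimensionLT (telescope D).X₂ (n + 1 + 1) :=
    hasProjectiveDimensionLT_of_ge (lin (teleSets D)) (n + 1) (n + 1 + 1) (by omega)
  exact res_of_hasProjectiveDimensionLT
    ((telescope_shortExact hD).hasProjectiveDimensionLT_X₃ (n + 1) h1 h2)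

end Telescope

/-! ### Resolutions for a direct union. -/

section DirectUnions

variable {G : Type u} [Group G] {F : Set (Subgroup G)} {Λ : Type v} {S : Λ → Subgroup G}

/-- The resolutions of the terms need not be compatible; the passage to the colimit happens in
`TorVanishes`, which involves no choice of resolution. -/
lemma res_isFlat_of_isEventuallyTrivial {J : Type u} [SmallCategory J] [IsFiltered J]
    {D : J ⥤ (OrbitCat F)ᵒᵖ ⥤ Type u} (hD : IsEventuallyTrivial D) {n : ℕ}
    (h : ∀ j, Res (fun M : RightModule F => IsFlat M) n (lin (D.obj j))) :
    Res (fun M : RightModule F => IsFlat M) n (trivialModule F) := by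
  have h1 : ∀ j, TorVanishes n (lin (D.obj j)) := fun j => (h j).torVanishes
  have h2 : TorVanishes n (augCocone D).pt := torVanishes_of_isColimit (augIsColimit hD) h1
  have h3 : TorVanishes n (trivialModule F) := h2
  exact res_of_torVanishes h3

lemma IsDirectUnion.isDirectedOrder (hS : IsDirectUnion S) :
    IsDirectedOrder {K // K ∈ Set.range S} := ⟨by
  rintro ⟨_, i, rfl⟩ ⟨_, j, rfl⟩
  obtain ⟨k, hik, hjk⟩ := hS.directed i j
  exact ⟨⟨S k, k, rfl⟩, hik, hjk⟩⟩

lemma IsDirectUnion.res_isFlat (hS : IsDirectUnion S) (hF : IsFullFamily F)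
    (hFS : ∀ H ∈ F, ∃ i, H ≤ S i) {n : ℕ}
    (h : ∀ i, Res IsFlat n (trivialModule (familyInter F (S i)))) :
    Res IsFlat n (trivialModule F) := by
  have hdir := hS.isDirectedOrder
  have : Nonempty {K // K ∈ Set.range S} := ⟨⟨S (hS.exists_mem 1).choose, _, rfl⟩⟩
  -- The index is the set of subgroups `S i`, ordered by inclusion: it is directed, and unlike `Λ`
  -- it lies in the universe of `G`.
  let T : {K // K ∈ Set.range S} ⥤ Subgroup G := (Subtype.mono_coe (· ∈ Set.range S)).functor
  have hT : IsEventuallyTrivial (T ⋙ cosetDiagram F) := isEventuallyTrivial_cosetDiagram T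
    (fun H hH => (hFS H hH).elim fun i hi => ⟨⟨S i, i, rfl⟩, hi⟩)
    (fun i j => (directed_of (· ≤ ·) i j).elim fun k hk => ⟨k, ⟨homOfLE hk.1⟩, ⟨homOfLE hk.2⟩⟩)
    fun g => (hS.exists_mem g).elim fun i hi => ⟨⟨S i, i, rfl⟩, hi⟩
  refine res_isFlat_of_isEventuallyTrivial hT fun K => ?_
  obtain ⟨i, hi⟩ := K.2
  have h1 := (h i).isFlat_cosetMaps hF (S i)
  rw [hi] at h1
  exact h1

lemma IsDirectUnion.res_projective [Countable Λ] (hS : IsDirectUnion S) (hF : IsFullFamily F)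
    (hFS : ∀ H ∈ F, ∃ i, H ≤ S i) {n : ℕ}
    (h : ∀ i, Res (fun M => Projective M) n (trivialModule (familyInter F (S i)))) :
    Res (fun M => Projective M) (n + 1) (trivialModule F) := by
  have := Encodable.ofCountable Λ
  have : Inhabited Λ := ⟨(hS.exists_mem 1).choose⟩
  have hdir : Directed (· ≤ ·) S := hS.directed
  -- An increasing cofinal sequence among the `S i`, obtained from an enumeration of `Λ`.
  let T : ℕ ⥤ Subgroup G := hdir.sequence_mono.functor
  have hT : IsEventuallyTrivial (T ⋙ cosetDiagram F) := isEventuallyTrivial_cosetDiagram T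
    (fun H hH => (hFS H hH).elim fun i hi => ⟨_, hi.trans (hdir.le_sequence i)⟩)
    (fun i j => ⟨max i j, ⟨homOfLE (le_max_left i j)⟩, ⟨homOfLE (le_max_right i j)⟩⟩)
    fun g => (hS.exists_mem g).elim fun i hi => ⟨_, hdir.le_sequence i hi⟩
  exact res_const_of_telescope hT fun i => (h _).projective_cosetMaps hF _

end DirectUnions

/-! ### From resolutions to inequalities between dimensions. -/

section Bounds

variable {C : Type*} [Category C] [Abelian C]

/-- A finite bound on the infimum is met by an actual length, since otherwise every length would be
at least `N + 1`. -/
lemma exists_hasResolution_of_iInf_le {P : C → Prop} {M : C} {N : ℕ}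
    (h : (⨅ (n : ℕ) (_ : HasResolution P M n), (n : ℕ∞)) ≤ N) :
    ∃ n ≤ N, HasResolution P M n := by
  by_contra! H
  have h1 : ((N + 1 : ℕ) : ℕ∞) ≤ ⨅ (n : ℕ) (_ : HasResolution P M n), (n : ℕ∞) :=
    le_iInf₂ fun n hn => Nat.cast_le.2 (Nat.succ_le_of_lt (not_le.1 fun hnN => H n hnN hn))
  exact absurd (Nat.cast_le.1 (h1.trans h)) (by omega)

variable {G : Type u} [Group G] {F : Set (Subgroup G)}

lemma hd_le_iff {n : ℕ} : hd G F ≤ n ↔ Res IsFlat n (trivialModule F) := by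
  refine ⟨fun h => ?_, fun h => iInf₂_le n h.hasResolution⟩
  obtain ⟨m, hm, hr⟩ := exists_hasResolution_of_iInf_le h
  exact Res.of_le (fun _ => isFlat_of_isZero _) hm (hr.res fun _ _ => isFlat_of_iso)

lemma cd_le_iff {n : ℕ} :
    cd G F ≤ n ↔ Res (fun M : RightModule F => Projective M) n (trivialModule F) := by
  refine ⟨fun h => ?_, fun h => iInf₂_le n h.hasResolution⟩
  obtain ⟨m, hm, hr⟩ := exists_hasResolution_of_iInf_le h
  exact Res.of_le (fun _ hZ => hZ.projective) hm (hr.res fun _ _ => Projective.of_iso)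

variable {Λ : Type v} {S : Λ → Subgroup G}

lemma IsDirectUnion.hd_le (hS : IsDirectUnion S) (hF : IsFullFamily F)
    (hFS : ∀ H ∈ F, ∃ i, H ≤ S i) : hd G F ≤ ⨆ i, hd (S i) (familyInter F (S i)) := by
  obtain h | ⟨N, hN⟩ := eq_or_ne (⨆ i, hd (S i) (familyInter F (S i))) ⊤ |>.imp_right
    ENat.ne_top_iff_exists.1
  · exact h ▸ le_top
  · rw [← hN, hd_le_iff]
    exact hS.res_isFlat hF hFS fun i => hd_le_iff.1 (hN ▸ le_iSup (fun i => hd (S i) (familyInter F (S i))) i)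

lemma IsDirectUnion.cd_le [Countable Λ] (hS : IsDirectUnion S) (hF : IsFullFamily F)
    (hFS : ∀ H ∈ F, ∃ i, H ≤ S i) : cd G F ≤ (⨆ i, cd (S i) (familyInter F (S i))) + 1 := by
  obtain h | ⟨N, hN⟩ := eq_or_ne (⨆ i, cd (S i) (familyInter F (S i))) ⊤ |>.imp_right
    ENat.ne_top_iff_exists.1
  · exact h ▸ le_top
  · rw [← hN]
    exact cd_le_iff.2 (hS.res_projective hF hFS fun i => cd_le_iff.1 (hN ▸ le_iSup (fun i => cd (S i) (familyInter F (S i))) i))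

lemma IsCompatible.exists_le {E : ∀ i, Set (Subgroup (S i))} (hE : IsCompatible S F E)
    {H : Subgroup G} (hH : H ∈ F) : ∃ i, H ≤ S i := by
  obtain ⟨i, L, -, rfl⟩ := Set.mem_iUnion.1 (hE.subset_iUnion hH)
  exact ⟨i, Subgroup.map_subtype_le L⟩

end Bounds

/-! ### The case where `G` belongs to the family. -/

section Terminal

variable {G : Type u} [Group G] {F : Set (Subgroup G)}

lemma subsingleton_hom_top (h : ⊤ ∈ F) (X : OrbitCat F) (f g : X ⟶ ⟨⊤, h⟩) : f = g :=
  MulActionHom.ext fun _ => (QuotientGroup.subsingleton_quotient_top).elim _ _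

/-- The morphism to the one-point orbit. -/
def toTop (h : ⊤ ∈ F) (X : OrbitCat F) : X ⟶ ⟨⊤, h⟩ :=
  cosetLE le_top

/-- The orbit `G/G` is terminal, so a map out of the constant module is freely determined by the
image of `1` there. -/
lemma projective_trivialModule (h : ⊤ ∈ F) : Projective (trivialModule F) where
  factors {N N'} f e he := by
    have hs : Function.Surjective ((e.app (op ⟨⊤, h⟩)).hom) := by
      rw [← AddCommGrpCat.epi_iff_surjective]
      infer_instance
    obtain ⟨n, hn⟩ := hs ((f.app (op ⟨⊤, h⟩)).hom (ULift.up (1 : ℤ)))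
    refine ⟨{ app := fun X => intHom (N.map (toTop h X.unop).op n), naturality := ?_ }, ?_⟩
    · intro X Y g
      refine int_hom_ext ((intHom_one _).trans ?_)
      refine Eq.trans ?_ (congrArg (N.map g).hom (intHom_one _)).symm
      have h1 : (toTop h Y.unop).op = (toTop h X.unop).op ≫ g :=
        Quiver.Hom.unop_inj (subsingleton_hom_top h _ _ _)
      rw [h1]
      exact congrArg (fun k => k.hom n) (N.map_comp (toTop h X.unop).op g)
    · ext X : 2
      refine int_hom_ext ((congrArg (e.app X).hom (intHom_one _)).trans ?_)
      refine (NatTrans.naturality_apply e (toTop h X.unop).op n).trans ?_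
      refine (congrArg (N'.map (toTop h X.unop).op).hom hn).trans ?_
      exact (NatTrans.naturality_apply f (toTop h X.unop).op (ULift.up (1 : ℤ))).symm

lemma cd_eq_zero_of_top_mem (h : ⊤ ∈ F) : cd G F = 0 :=
  le_antisymm (cd_le_iff.2 (projective_trivialModule h)) bot_le

lemma hd_eq_zero_of_top_mem (h : ⊤ ∈ F) : hd G F = 0 :=
  le_antisymm (hd_le_iff.2 (have := projective_trivialModule h; isFlat_of_projective _)) bot_le

end Terminal

/-! ### Virtually cyclic groups and part (b). -/

section VirtuallyCyclic

lemma IsVirtuallyCyclic.of_injective {A B : Type u} [Group A] [Group B] (f : A →* B)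
    (hf : Function.Injective f) (h : IsVirtuallyCyclic B) : IsVirtuallyCyclic A := by
  obtain ⟨C, hC, hfin⟩ := h
  refine ⟨C.comap f, ?_, ⟨?_⟩⟩
  · exact isCyclic_of_injective (f.subgroupComap C)
      fun x y hxy => Subtype.ext (hf (congrArg Subtype.val hxy))
  · rw [Subgroup.index_comap]
    exact Subgroup.FiniteIndex.index_ne_zero (H := C.subgroupOf f.range)

/-- A generator of the cyclic subgroup together with finitely many coset representatives generates
the group. Hence every member of the family is one of the subgroups in the directed union. -/
lemma IsVirtuallyCyclic.fg {A : Type u} [Group A] (h : IsVirtuallyCyclic A) : Group.FG A := by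
  obtain ⟨C, hC, hfin⟩ := h
  obtain ⟨c, hc⟩ := (Subgroup.isCyclic_iff_exists_zpowers_eq_top C).1 hC
  have : Finite (Quotient (QuotientGroup.leftRel C)) := inferInstanceAs (Finite (A ⧸ C))
  refine Group.fg_iff.2 ⟨{c} ∪ Set.range (Quotient.out : A ⧸ C → A), ?_,
    (Set.finite_singleton c).union (Set.finite_range _)⟩
  refine (Subgroup.eq_top_iff' _).2 fun x => ?_
  obtain ⟨k, hk⟩ := QuotientGroup.mk_out_eq_mul C x
  have hk' : (k : A) ∈ Subgroup.closure ({c} ∪ Set.range (Quotient.out : A ⧸ C → A)) := by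
    have : C ≤ Subgroup.closure ({c} ∪ Set.range (Quotient.out : A ⧸ C → A)) := by
      rw [← hc, Subgroup.zpowers_eq_closure]
      exact Subgroup.closure_mono Set.subset_union_left
    exact this k.2
  rw [eq_mul_inv_of_mul_eq hk.symm]
  exact Subgroup.mul_mem _ (Subgroup.subset_closure (Or.inr ⟨_, rfl⟩))
    (Subgroup.inv_mem _ hk')

variable (G : Type u) [Group G]

lemma isFullFamily_vcFamily : IsFullFamily (vcFamily G) where
  nonempty := ⟨⊥, ⊤, inferInstance, inferInstance⟩
  conj_mem H hH g := by
    let e := H.equivMapOfInjective (MulAut.conj g).toMonoidHom (MulAut.conj g).injective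
    exact IsVirtuallyCyclic.of_injective e.symm.toMonoidHom e.symm.injective hH
  subgroup_mem H hH K hK :=
    IsVirtuallyCyclic.of_injective (Subgroup.inclusion hK) (Subgroup.inclusion_injective hK) hH

lemma isDirectUnion_fg : IsDirectUnion (Subtype.val : {D : Subgroup G // D.FG} → Subgroup G) where
  directed D D' := ⟨⟨D.1 ⊔ D'.1, D.2.sup D'.2⟩, le_sup_left, le_sup_right⟩
  exists_mem g := ⟨⟨Subgroup.zpowers g, {g}, by
    rw [Finset.coe_singleton, Subgroup.zpowers_eq_closure]⟩, Subgroup.mem_zpowers g⟩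

instance countable_fg [Countable G] : Countable {D : Subgroup G // D.FG} := by
  choose s hs using fun D : {D : Subgroup G // D.FG} => D.2
  have : Function.Injective s := fun D D' h => Subtype.ext (by rw [← hs D, ← hs D', h])
  exact this.countable

variable {G}

lemma exists_fg_of_mem_vcFamily {H : Subgroup G} (hH : H ∈ vcFamily G) :
    ∃ D : {D : Subgroup G // D.FG}, H ≤ D.1 :=
  ⟨⟨H, (Group.fg_iff_subgroup_fg H).1 (IsVirtuallyCyclic.fg hH)⟩, le_rfl⟩

lemma IsLocallyVirtuallyCyclic.top_mem (h : IsLocallyVirtuallyCyclic G)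
    (D : {D : Subgroup G // D.FG}) : ⊤ ∈ familyInter (vcFamily G) D.1 :=
  ⟨D.1, h D.1 D.2, (Subgroup.subgroupOf_self D.1).symm⟩

lemma IsLocallyVirtuallyCyclic.hd_eq_zero (h : IsLocallyVirtuallyCyclic G) :
    hd G (vcFamily G) = 0 := by
  refine le_antisymm (((isDirectUnion_fg G).hd_le (isFullFamily_vcFamily G)
    fun _ => exists_fg_of_mem_vcFamily).trans (iSup_le fun D => ?_)) bot_le
  exact (hd_eq_zero_of_top_mem (h.top_mem D)).le

lemma IsLocallyVirtuallyCyclic.cd_le_one [Countable G] (h : IsLocallyVirtuallyCyclic G) :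
    cd G (vcFamily G) ≤ 1 := by
  refine ((isDirectUnion_fg G).cd_le (isFullFamily_vcFamily G)
    fun _ => exists_fg_of_mem_vcFamily).trans ?_
  rw [iSup_congr fun D => cd_eq_zero_of_top_mem (h.top_mem D)]
  simp

end VirtuallyCyclic

end Bredon

theorem mainTheorem6 (G : Type u) [Group G] :
    (∀ (Λ : Type v) (S : Λ → Subgroup G) (F : Set (Subgroup G))
        (E : ∀ i : Λ, Set (Subgroup (S i))),
      Bredon.IsDirectUnion S →
      Bredon.IsFullFamily F →
      (∀ i, Bredon.IsFullFamily (E i)) →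
      Bredon.IsCompatible S F E →
        Bredon.hd G F ≤ (⨆ i, Bredon.hd (S i) (E i)) ∧
        (Countable Λ → Bredon.cd G F ≤ (⨆ i, Bredon.cd (S i) (E i)) + 1)) ∧
    (Bredon.IsLocallyVirtuallyCyclic G →
      Bredon.hd G (Bredon.vcFamily G) = 0 ∧
      (Countable G → Bredon.cd G (Bredon.vcFamily G) ≤ 1)) := by
  refine ⟨fun Λ S F E hS hF _ hE => ?_, fun h => ⟨h.hd_eq_zero, fun _ => h.cd_le_one⟩⟩
  -- Compatibility determines each `E i` as `F ∩ S i`, the form in which the bounds are stated.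
  obtain rfl : E = fun i => Bredon.familyInter F (S i) := funext hE.eq_inter
  exact ⟨hS.hd_le hF fun _ => hE.exists_le, fun _ => hS.cd_le hF fun _ => hE.exists_le⟩
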